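/- Let $\Omega\subset\mathbb R^m$ be a polyhedral domain with a simplicial triangulation $\mathcal T_h$ by finitely many $m$-simplices, and let $\mathcal E_h=\bigcup_{K\in\mathcal T_h}\partial K$. For each $K\in\mathcal T_h$ let $V(K)\subset[H^2(K)]^n$ and $\Sigma(K)\subset[H^1(K)]^{mn}$ be finite-dimensional subspaces, and let $V^*(K)$ be the dual of $V(K)$, realized by a subspace of $[L^2(K)]^n$ through the pairing $(r,v)\mapsto\int_K r_iv^i\,d^mx$ (sums over repeated indices $i=1,\dots,n$, $\mu=1,\dots,m$ are implied). Put $V=\prod_KV(K)$, $\Sigma=\prod_K\Sigma(K)$, $V^*=\prod_KV^*(K)$, and let $\widehat V$ be a subspace of $[L^2(\mathcal E_h)]^n$. Let $\Phi$ be a numerical flux function, determining $\widehat\sigma=\Phi(u,\sigma,\widehat u)\in\prod_K[L^2(\partial K)]^{mn}$ from $(u,\sigma,\widehat u)\in V\times\Sigma\times\widehat V$, and let $H=H(t,x,u,p,\sigma)$ be a Hamiltonian on $(t_0,t_1)\times\Omega\times\mathbb R^n\times\mathbb R^n\times\mathbb R^{mn}$ that is $C^2$ in $(u,p,\sigma)$.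 Write $d^{m-1}x_\mu=N_\mu\,dS$ on $\partial K$, with $N$ the outer unit normal and $dS$ the surface measure; on $\partial K$, functions in $H^1(K)$ are understood as traces. Fix $K\in\mathcal T_h$, and let $(u(t),\sigma(t),p(t),\widehat u(t))\in V\times\Sigma\times V^*\times\widehat V$, $t\in(t_0,t_1)$, satisfy the semidiscrete de Donder–Weyl equations on $K$: $$\int_K\dot u^ir_i\,d^mx=\int_K\frac{\partial H}{\partial p_i}r_i\,d^mx\quad\forall r\in V^*(K),$$ $$0=\int_K\Bigl(u^i\partial_\mu\tau_i^\mu+\frac{\partial H}{\partial\sigma_i^\mu}\tau_i^\mu\Bigr)d^mx-\int_{\partial K}\widehat u^i\tau_i^\mu\,d^{m-1}x_\mu\quad\forall\tau\in\Sigma(K),$$ $$\int_K\dot p_iv^i\,d^mx=\int_K\Bigl(\sigma_i^\mu\partial_\mu v^i-\frac{\partial H}{\partial u^i}v^i\Bigr)d^mx-\int_{\partial K}\widehat\sigma_i^\mu v^i\,d^{m-1}x_\mu\quad\forall v\in V(K),$$ where $u$ and $p$ are differentiable in time on $K$, all integrals exist, and $\Phi$ is differentiable at $(u(t),\sigma(t),\widehat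 u(t))$. A (first) variation of the solution on $K$ is a family $(v(t),\tau(t),r(t),\widehat v(t))\in V\times\Sigma\times V^*\times\widehat V$, with $v$ and $r$ differentiable in time on $K$, satisfying the linearization of these three equations: $u,\sigma,p,\widehat u$ are replaced by $v,\tau,r,\widehat v$; the first derivatives of $H$ are replaced by its Hessian in $(u,p,\sigma)$, evaluated at $(t,x,u,p,\sigma)$ and applied to $(v,r,\tau)$; $\widehat\sigma$ is replaced by $\widehat\tau=\Phi'(u,\sigma,\widehat u)(v,\tau,\widehat v)$; and all integrals exist. For two variations, $\mathrm du^i\wedge\mathrm dp_i$ denotes $v^ir_i'-v'^ir_i$, $\mathrm d\widehat u^i\wedge\mathrm d\widehat\sigma_i^\mu$ denotes $\widehat v^i\widehat\tau_i'^\mu-\widehat v'^i\widehat\tau_i^\mu$, and $\mathrm d(\widehat u^i-u^i)\wedge\mathrm d(\widehat\sigma_i^\mu-\sigma_i^\mu)$ denotes $(\widehat v^i-v^i)(\widehat\tau_i'^\mu-\tau_i'^\mu)-(\widehat v'^i-v'^i)(\widehat\tau_i^\mu-\tau_i^\mu)$. **Theorem.** For every pair of variations on $K$ and every $t\in(t_0,t_1)$,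 the density $\mathrm du^i\wedge\mathrm dp_i$ is differentiable in time (as a curve in $L^1(K)$), and $$\int_K\partial_t(\mathrm du^i\wedge\mathrm dp_i)\,d^mx=-\int_{\partial K}(\mathrm d\widehat u^i\wedge\mathrm d\widehat\sigma_i^\mu)\,d^{m-1}x_\mu+\int_{\partial K}\bigl(\mathrm d(\widehat u^i-u^i)\wedge\mathrm d(\widehat\sigma_i^\mu-\sigma_i^\mu)\bigr)\,d^{m-1}x_\mu.$$ Consequently, the semidiscrete multisymplectic conservation law $$\int_K\partial_t(\mathrm du^i\wedge\mathrm dp_i)\,d^mx=-\int_{\partial K}(\mathrm d\widehat u^i\wedge\mathrm d\widehat\sigma_i^\mu)\,d^{m-1}x_\mu$$ holds on $K$ if and only if $\int_{\partial K}\bigl(\mathrm d(\widehat u^i-u^i)\wedge\mathrm d(\widehat\sigma_i^\mu-\sigma_i^\mu)\bigr)\,d^{m-1}x_\mu=0$; this holds both for each pair of variations at each time, and for the statements asserted for all pairs of variations and all times. -/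

import Mathlib

open MeasureTheory Set Filter Topology
open scoped ContDiff

noncomputable section

namespace HybridDDW

/-- Space `ℝ^m`. -/
abbrev Space (m : ℕ) := EuclideanSpace ℝ (Fin m)

/-- Values of `u`, and of `p`: the component `u^i` is `u i`. -/
abbrev Fld (n : ℕ) := EuclideanSpace ℝ (Fin n)

/-- Values of `σ`: the component `σ_i^μ` is `σ (μ, i)`. -/
abbrev Flx (m n : ℕ) := EuclideanSpace ℝ (Fin m × Fin n)

/-- The space `ℝ^n × ℝ^n × ℝ^{mn}` of values of `(u, p, σ)`. -/
abbrev Phase (m n : ℕ) := Fld n × Fld n × Flx m n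

/-! ### Measures, normals and Sobolev spaces on a convex body `K` -/

/-- Lebesgue measure on `K`. -/
abbrev vol {m : ℕ} (K : Set (Space m)) : Measure (Space m) := volume.restrict K

/-- `(m-1)`-dimensional surface measure on a set `B` (used for `B = ∂K` and for the skeleton). -/
abbrev surf {m : ℕ} (B : Set (Space m)) : Measure (Space m) :=
  (Measure.euclideanHausdorffMeasure (m - 1)).restrict B

/-- The outer unit normal of a convex body `K` at `x ∈ ∂K`: the unit vector `N` such that `K` lies in
the half space `⟪N, y - x⟫ ≤ 0`, at those `x` where there is exactly one such vector (for a simplex,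
these are the boundary points in the relative interiors of the facets; the others form a set of
surface measure zero, where the value is set to `0`). -/
def outerNormal {m : ℕ} (K : Set (Space m)) (x : Space m) : Space m :=
  open Classical in
  if h : ∃! N : Space m, ‖N‖ = 1 ∧ ∀ y ∈ K, inner ℝ N (y - x) ≤ 0 then h.choose else 0

/-- `g` is the weak partial derivative `∂_μ f` in the interior of `K`. -/
def HasWeakPartial {m : ℕ} (K : Set (Space m)) (μ : Fin m) (f g : Lp ℝ 2 (vol K)) : Prop :=
  ∀ φ : Space m → ℝ, ContDiff ℝ ∞ φ → HasCompactSupport φ → tsupport φ ⊆ interior K →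
    ∫ x in K, f x * fderiv ℝ φ x (EuclideanSpace.single μ 1) = - ∫ x in K, g x * φ x

/-- `f ∈ H¹(K)`. -/
def MemH1 {m : ℕ} (K : Set (Space m)) (f : Lp ℝ 2 (vol K)) : Prop :=
  ∀ μ : Fin m, ∃ g : Lp ℝ 2 (vol K), HasWeakPartial K μ f g

/-- `f ∈ H²(K)`. -/
def MemH2 {m : ℕ} (K : Set (Space m)) (f : Lp ℝ 2 (vol K)) : Prop :=
  ∀ μ : Fin m, ∃ g : Lp ℝ 2 (vol K), HasWeakPartial K μ f g ∧ MemH1 K g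

/-- The weak partial derivative `∂_μ f` (which is unique when it exists). -/
def weakPartial {m : ℕ} (K : Set (Space m)) (μ : Fin m) (f : Lp ℝ 2 (vol K)) : Lp ℝ 2 (vol K) :=
  open Classical in
  if h : ∃ g : Lp ℝ 2 (vol K), HasWeakPartial K μ f g then h.choose else 0

/-- `g ∈ L²(∂K)` is the trace of `f ∈ H¹(K)`: some sequence of functions that are smooth on all of
space converges to `f` in `H¹(K)` while its restrictions to `∂K` converge to `g` in `L²(∂K)`. -/
def IsTrace {m : ℕ} (K : Set (Space m)) (f : Lp ℝ 2 (vol K)) (g : Lp ℝ 2 (surf (frontier K))) :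
    Prop :=
  ∃ φ : ℕ → Space m → ℝ, (∀ k, ContDiff ℝ ∞ (φ k)) ∧
    Tendsto (fun k => eLpNorm (fun x => φ k x - f x) 2 (vol K)) atTop (𝓝 0) ∧
    (∀ μ : Fin m, Tendsto (fun k => eLpNorm (fun x =>
      fderiv ℝ (φ k) x (EuclideanSpace.single μ 1) - weakPartial K μ f x) 2 (vol K)) atTop (𝓝 0)) ∧
    Tendsto (fun k => eLpNorm (fun x => φ k x - g x) 2 (surf (frontier K))) atTop (𝓝 0)

/-- The trace on `∂K` of `f ∈ H¹(K)`. -/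
def trace {m : ℕ} (K : Set (Space m)) (f : Lp ℝ 2 (vol K)) : Lp ℝ 2 (surf (frontier K)) :=
  open Classical in
  if h : ∃ g : Lp ℝ 2 (surf (frontier K)), IsTrace K f g then h.choose else 0

/-- The component with index `i` of a vector-valued square-integrable function. -/
def comp {m : ℕ} {ι : Type} [Fintype ι] {K : Set (Space m)} (i : ι)
    (f : Lp (EuclideanSpace ℝ ι) 2 (vol K)) : Lp ℝ 2 (vol K) :=
  (EuclideanSpace.proj i : EuclideanSpace ℝ ι →L[ℝ] ℝ).compLp f

/-- The componentwise trace of a vector-valued function. -/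
def traceVec {m : ℕ} {ι : Type} [Fintype ι] {K : Set (Space m)}
    (f : Lp (EuclideanSpace ℝ ι) 2 (vol K)) (x : Space m) : EuclideanSpace ℝ ι :=
  WithLp.toLp 2 fun i => trace K (comp i f) x

/-- The boundary integral `∫_{∂K} a^i b_i^μ d^{m-1}x_μ`, where `d^{m-1}x_μ` is `N_μ` times surface
measure, with `N` the outer unit normal. -/
def bdryInt {m n : ℕ} (K : Set (Space m)) (a : Space m → Fld n) (b : Space m → Flx m n) : ℝ :=
  ∫ x, ∑ i, ∑ μ, a x i * b x (μ, i) * outerNormal K x μ ∂surf (frontier K)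

/-- The boundary integral `∫_{∂K} (a^i b'_i^μ - a'^i b_i^μ) d^{m-1}x_μ` of the 2-form `da ∧ db`
evaluated on a pair of variations `(a, b)`, `(a', b')`. -/
def bdryWedge {m n : ℕ} (K : Set (Space m)) (a : Space m → Fld n) (b : Space m → Flx m n)
    (a' : Space m → Fld n) (b' : Space m → Flx m n) : ℝ :=
  ∫ x, ∑ i, ∑ μ, (a x i * b' x (μ, i) - a' x i * b x (μ, i)) * outerNormal K x μ
    ∂surf (frontier K)

/-- The density `v^i r'_i - v'^i r_i`, in `L¹(K)`: the 2-form `du^i ∧ dp_i` evaluated on a pair of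
variations whose `(u, p)` components are `(v, r)` and `(v', r')`. -/
def omegaZero {m n : ℕ} {K : Set (Space m)} (v r v' r' : Lp (Fld n) 2 (vol K)) : Lp ℝ 1 (vol K) :=
  ((L2.integrable_inner (𝕜 := ℝ) v r').sub (L2.integrable_inner (𝕜 := ℝ) v' r)).toL1 _

/-! ### Triangulations and finite element spaces -/

/-- `T` is a simplicial triangulation of the polyhedral domain `Ω ⊆ ℝ^m` by `m`-simplices. -/
structure IsTriangulation {m : ℕ} (T : Geometry.SimplicialComplex ℝ (Space m))
    (Ω : Set (Space m)) : Prop where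
  finite : T.faces.Finite
  pure : ∀ s ∈ T.faces, ∃ K ∈ T.faces, s ⊆ K ∧ K.card = m + 1
  eq_interior : Ω = interior T.space

/-- The `m`-simplices of a triangulation, given by their vertices. -/
abbrev Element {m : ℕ} (T : Geometry.SimplicialComplex ℝ (Space m)) :=
  {K : Finset (Space m) // K ∈ T.faces ∧ K.card = m + 1}

/-- The closed simplex with the given vertices. -/
abbrev Element.body {m : ℕ} {T : Geometry.SimplicialComplex ℝ (Space m)} (K : Element T) :
    Set (Space m) :=
  convexHull ℝ (K.1 : Set (Space m))

/-- The union of the boundaries `∂K` of all elements. -/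
abbrev skeleton {m : ℕ} (T : Geometry.SimplicialComplex ℝ (Space m)) : Set (Space m) :=
  ⋃ K : Element T, frontier K.body

/-- A choice of finite element spaces on a triangulation. The dual space `V(K)^*` is realized, as it
has to be for `H(t, x, u, p, σ)` to make sense, by functions `p` acting through `v ↦ ∫_K p_i v^i`. -/
structure Spaces {m : ℕ} (T : Geometry.SimplicialComplex ℝ (Space m)) (n : ℕ) where
  V : ∀ K : Element T, Submodule ℝ (Lp (Fld n) 2 (vol K.body))
  Vdual : ∀ K : Element T, Submodule ℝ (Lp (Fld n) 2 (vol K.body))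
  S : ∀ K : Element T, Submodule ℝ (Lp (Flx m n) 2 (vol K.body))
  Vhat : Submodule ℝ (Lp (Fld n) 2 (surf (skeleton T)))
  V_finite : ∀ K, FiniteDimensional ℝ (V K)
  S_finite : ∀ K, FiniteDimensional ℝ (S K)
  V_H2 : ∀ K, ∀ v ∈ V K, ∀ i, MemH2 K.body (comp i v)
  S_H1 : ∀ K, ∀ τ ∈ S K, ∀ j, MemH1 K.body (comp j τ)
  Vdual_dual : ∀ K, ∀ ℓ : V K →ₗ[ℝ] ℝ, ∃! r : Vdual K, ∀ v : V K,
    ∫ x in K.body, inner ℝ (r.1 x) (v.1 x) = ℓ v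

/-- A numerical flux function: it determines `σ̂`, on the boundary of each element, from `u`, `σ`
and `û`. -/
abbrev FluxFunction {m n : ℕ} {T : Geometry.SimplicialComplex ℝ (Space m)} (X : Spaces T n) :=
  (∀ K, X.V K) × (∀ K, X.S K) × X.Vhat →
    ∀ K : Element T, Lp (Flx m n) 2 (surf (frontier K.body))

/-- Time-dependent fields `(u(t), p(t), σ(t), û(t)) ∈ V × V^* × Σ × V̂`. -/
structure Fields {m n : ℕ} {T : Geometry.SimplicialComplex ℝ (Space m)} (X : Spaces T n) where
  u : ℝ → ∀ K, X.V K
  p : ℝ → ∀ K, X.Vdual K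
  σ : ℝ → ∀ K, X.S K
  uhat : ℝ → X.Vhat

section

variable {m n : ℕ} {T : Geometry.SimplicialComplex ℝ (Space m)} {X : Spaces T n}

/-- The values of `(u, p, σ)` at the time `t` and the point `x` of the element `K`. -/
def Fields.val (y : Fields X) (K : Element T) (t : ℝ) (x : Space m) : Phase m n :=
  ((y.u t K).1 x, (y.p t K).1 x, (y.σ t K).1 x)

/-- The argument `(u, σ, û)` of the flux function. -/
def Fields.arg (y : Fields X) (t : ℝ) : (∀ K, X.V K) × (∀ K, X.S K) × X.Vhat :=
  (y.u t, y.σ t, y.uhat t)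

/-- The three weak equations on the element `K` at time `t`, for all test functions `r ∈ V(K)^*`,
`τ ∈ Σ(K)` and `v ∈ V(K)`, where `û`, `σ̂` are the approximate traces and `G x` is a covector on phase
space whose components stand in the places of `(∂H/∂u, ∂H/∂p, ∂H/∂σ)`. It is understood that `u` and
`p` are differentiable in time and that the integrals exist. -/
structure WeakEquations (y : Fields X) (G : Space m → Phase m n →L[ℝ] ℝ)
    (σhat : Space m → Flx m n) (K : Element T) (t : ℝ) : Prop where
  diff_u : DifferentiableAt ℝ (fun s => y.u s K) t
  diff_p : DifferentiableAt ℝ (fun s => y.p s K) t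
  int_r : ∀ r : X.Vdual K, Integrable (fun x => G x (0, r.1 x, 0)) (vol K.body)
  int_τ : ∀ τ : X.S K, Integrable (fun x => G x (0, 0, τ.1 x)) (vol K.body)
  int_v : ∀ v : X.V K, Integrable (fun x => G x (v.1 x, 0, 0)) (vol K.body)
  eq_r : ∀ r : X.Vdual K,
    ∫ x in K.body, ∑ i, (deriv (fun s => y.u s K) t).1 x i * r.1 x i =
      ∫ x in K.body, G x (0, r.1 x, 0)
  eq_τ : ∀ τ : X.S K,
    0 = (∫ x in K.body,
          ((∑ i, ∑ μ, (y.u t K).1 x i * weakPartial K.body μ (comp (μ, i) τ.1) x) +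
            G x (0, 0, τ.1 x))) -
        bdryInt K.body (y.uhat t).1 (traceVec τ.1)
  eq_v : ∀ v : X.V K,
    ∫ x in K.body, ∑ i, (deriv (fun s => y.p s K) t).1 x i * v.1 x i =
      (∫ x in K.body,
          ((∑ i, ∑ μ, (y.σ t K).1 x (μ, i) * weakPartial K.body μ (comp i v.1) x) -
            G x (v.1 x, 0, 0))) -
        bdryInt K.body (traceVec v.1) σhat

/-- `y = (u, p, σ, û)` satisfies the semidiscrete de Donder–Weyl equations on `K` at time `t`, for
the Hamiltonian `H` and the flux function `Φ`. -/
def SolvesOn (H : ℝ → Space m → Phase m n → ℝ) (Φ : FluxFunction X) (y : Fields X)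
    (K : Element T) (t : ℝ) : Prop :=
  WeakEquations y (fun x => fderiv ℝ (H t x) (y.val K t x)) (Φ (y.arg t) K) K t

variable [Fintype (Element T)]

/-- The variation `dσ̂` of the numerical flux induced by the variation `z` of `y`. -/
def fluxVariation (Φ : FluxFunction X) (y z : Fields X) (K : Element T) (t : ℝ) :
    Lp (Flx m n) 2 (surf (frontier K.body)) :=
  fderiv ℝ Φ (y.arg t) (z.arg t) K

/-- `z = (v, r, τ, v̂)` satisfies on `K` at time `t` the linearization of the semidiscrete equations
about `y = (u, p, σ, û)`: the first derivatives of `H` are replaced by its Hessian at `(u, p, σ)`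
applied to `(v, r, τ)`, and `σ̂` by its variation. -/
def LinearizedOn (H : ℝ → Space m → Phase m n → ℝ) (Φ : FluxFunction X) (y z : Fields X)
    (K : Element T) (t : ℝ) : Prop :=
  WeakEquations z (fun x => fderiv ℝ (fderiv ℝ (H t x)) (y.val K t x) (z.val K t x))
    (fluxVariation Φ y z K t) K t

/-- `z` is a first variation, on `K`, of the solution `y` on the time interval `(t₀, t₁)`. -/
def IsVariation (H : ℝ → Space m → Phase m n → ℝ) (Φ : FluxFunction X) (t₀ t₁ : ℝ)
    (y z : Fields X) (K : Element T) : Prop :=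
  ∀ t ∈ Ioo t₀ t₁, LinearizedOn H Φ y z K t

/-- The curve `t ↦ du^i ∧ dp_i` in `L¹(K)`, evaluated on the variations `z`, `z'`. -/
def density (z z' : Fields X) (K : Element T) (t : ℝ) : Lp ℝ 1 (vol K.body) :=
  omegaZero (z.u t K).1 (z.p t K).1 (z'.u t K).1 (z'.p t K).1

/-- `∫_K ∂_t (du^i ∧ dp_i) d^m x`, evaluated on the variations `z`, `z'`. -/
def rateOfChange (z z' : Fields X) (K : Element T) (t : ℝ) : ℝ :=
  ∫ x in K.body, (deriv (density z z' K) t) x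

/-- `∫_{∂K} (dû^i ∧ dσ̂_i^μ) d^{m-1}x_μ`, evaluated on the variations `z`, `z'` of `y`. -/
def boundaryFlux (Φ : FluxFunction X) (y z z' : Fields X) (K : Element T) (t : ℝ) : ℝ :=
  bdryWedge K.body (z.uhat t).1 (fluxVariation Φ y z K t)
    (z'.uhat t).1 (fluxVariation Φ y z' K t)

/-- `∫_{∂K} (d(û^i - u^i) ∧ d(σ̂_i^μ - σ_i^μ)) d^{m-1}x_μ`, evaluated on the variations `z`, `z'` of
`y`. -/
def boundaryDefect (Φ : FluxFunction X) (y z z' : Fields X) (K : Element T) (t : ℝ) : ℝ :=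
  bdryWedge K.body
    (fun x => (z.uhat t).1 x - traceVec (z.u t K).1 x)
    (fun x => fluxVariation Φ y z K t x - traceVec (z.σ t K).1 x)
    (fun x => (z'.uhat t).1 x - traceVec (z'.u t K).1 x)
    (fun x => fluxVariation Φ y z' K t x - traceVec (z'.σ t K).1 x)

end

end HybridDDW

end

/-!
Testing the linearized equations of one variation with the other variation, and subtracting,
expresses `∫_K ∂_t (du^i ∧ dp_i)` through volume and boundary terms. The volume terms that contain
the Hessian of `H` cancel by its symmetry. The others pair up as `∫_K (v ∂_μ τ + τ ∂_μ v)`, and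
integration by parts turns each pair into the boundary integral of the product of the traces.
Together with the terms in the numerical traces and fluxes, these are the expansion of the two wedge
products on the right-hand side.

Integration by parts on `H¹(K)` rests on three facts about a simplex.
* Gauss–Green for smooth functions. By linearity the direction may be taken along an edge. A line
  parallel to the edge from `b k` to `b l` enters and leaves the simplex through the two facets
  opposite to these vertices, so the fundamental theorem of calculus on these lines produces
  integrals over the shadows of the two facets along the edge, and the shadow along the unit vector
  `e` of a facet with unit normal `ν` has `|⟪ν, e⟫|` times the measure of the facet. The other
  facets are parallel to the edge.
* The trace inequality: apply the divergence theorem to `F² • (x - x₀)` with `x₀` an interior point,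
  since `⟪N, x - x₀⟫` is bounded below by a positive constant on `∂K`.
* Density of smooth functions: dilate towards the interior of the simplex, then mollify, so that the
  kernel never reaches across `∂K`.
-/

namespace HybridDDW

noncomputable section BarycentricCoordinates

variable {E ι : Type*} [NormedAddCommGroup E] [InnerProductSpace ℝ E] (b : AffineBasis ι ℝ E)

/-- The facet, opposite to the vertex `b i`, of the simplex spanned by `b`. -/
def facet (i : ι) : Set E := {x | (∀ j, 0 ≤ b.coord j x) ∧ b.coord i x = 0}

theorem isCompact_convexHull_range [Finite ι] : IsCompact (convexHull ℝ (range b)) :=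
  (finite_range b).isCompact_convexHull (𝕜 := ℝ)

theorem facet_subset_convexHull (i : ι) : facet b i ⊆ convexHull ℝ (range b) := by
  rw [b.convexHull_eq_nonneg_coord]
  exact fun x hx => hx.1

theorem frontier_convexHull_range [Finite ι] :
    frontier (convexHull ℝ (range b)) = ⋃ i, facet b i := by
  rw [frontier, (isCompact_convexHull_range b).isClosed.closure_eq, b.interior_convexHull,
    b.convexHull_eq_nonneg_coord]
  ext x
  simp only [Set.mem_sdiff, mem_ofPred_eq, not_forall, not_lt, mem_iUnion, facet]
  constructor
  · rintro ⟨h, i, hi⟩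
    exact ⟨i, h, le_antisymm hi (h i)⟩
  · rintro ⟨i, h, hi⟩
    exact ⟨h, i, hi.le⟩

variable [FiniteDimensional ℝ E]

/-- The gradient of a barycentric coordinate. -/
def coordGrad (i : ι) : E :=
  (InnerProductSpace.toDual ℝ E).symm (b.coord i).linear.toContinuousLinearMap

theorem coord_add (i : ι) (x w : E) :
    b.coord i (x + w) = b.coord i x + inner ℝ (coordGrad b i) w := by
  rw [add_comm x w, ← vadd_eq_add, AffineMap.map_vadd, vadd_eq_add, add_comm]
  simp [coordGrad]

theorem inner_coordGrad_sub (i : ι) (x y : E) :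
    inner ℝ (coordGrad b i) (x - y) = b.coord i x - b.coord i y := by
  rw [eq_sub_iff_add_eq', ← coord_add, add_sub_cancel]

theorem coordGrad_ne_zero {i : ι} {x : E} (hx : b.coord i x = 0) : coordGrad b i ≠ 0 := by
  intro h
  simpa [h, hx] using inner_coordGrad_sub b i (b i) x

/-- The inner unit normal of a facet (it is `0` if `b i` is the only vertex). -/
def facetNormal (i : ι) : E := ‖coordGrad b i‖⁻¹ • coordGrad b i

theorem norm_facetNormal {i : ι} {x : E} (hx : b.coord i x = 0) : ‖facetNormal b i‖ = 1 :=
  norm_smul_inv_norm (𝕜 := ℝ) (coordGrad_ne_zero b hx)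

theorem inner_facetNormal (i : ι) (w : E) :
    inner ℝ (facetNormal b i) w = ‖coordGrad b i‖⁻¹ * inner ℝ (coordGrad b i) w :=
  real_inner_smul_left _ _ _

theorem inner_facetNormal_sub_eq_zero {i : ι} {x p : E} (hx : b.coord i x = 0)
    (hp : b.coord i p = 0) : inner ℝ (facetNormal b i) (x - p) = 0 := by
  rw [inner_facetNormal, inner_coordGrad_sub, hx, hp, sub_self, mul_zero]

theorem isClosed_facet (i : ι) : IsClosed (facet b i) := by
  have hfacet : facet b i = (⋂ j, b.coord j ⁻¹' Ici 0) ∩ b.coord i ⁻¹' {0} := by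
    ext; simp [facet]
  rw [hfacet]
  exact (isClosed_iInter fun j => isClosed_Ici.preimage (continuous_barycentric_coord b j)).inter
    (isClosed_singleton.preimage (continuous_barycentric_coord b i))

theorem isCompact_facet [Finite ι] (i : ι) : IsCompact (facet b i) :=
  (isCompact_convexHull_range b).of_isClosed_subset (isClosed_facet b i)
    (facet_subset_convexHull b i)

end BarycentricCoordinates

section OuterNormal

theorem outerNormal_eq_of_unique {m : ℕ} {K : Set (Space m)} {x N : Space m}
    (hN : ‖N‖ = 1 ∧ ∀ y ∈ K, inner ℝ N (y - x) ≤ 0)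
    (huniq : ∀ N', (‖N'‖ = 1 ∧ ∀ y ∈ K, inner ℝ N' (y - x) ≤ 0) → N' = N) :
    outerNormal K x = N := by
  have h : ∃! N : Space m, ‖N‖ = 1 ∧ ∀ y ∈ K, inner ℝ N (y - x) ≤ 0 := ⟨N, hN, huniq⟩
  rw [outerNormal, dif_pos h]
  exact huniq _ h.choose_spec.1

theorem norm_outerNormal_le {m : ℕ} (K : Set (Space m)) (x : Space m) : ‖outerNormal K x‖ ≤ 1 := by
  rw [outerNormal]
  split_ifs with h
  · exact h.choose_spec.1.1.le
  · simp

theorem eq_neg_of_forall_inner_nonpos {E : Type*} [NormedAddCommGroup E] [InnerProductSpace ℝ E]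
    {ν N : E} (hν : ‖ν‖ = 1) (hN : ‖N‖ = 1)
    (h : ∀ w, 0 ≤ inner ℝ ν w → inner ℝ N w ≤ 0) : N = -ν := by
  have hge : -1 ≤ inner ℝ ν N := by
    simpa [hν, hN] using neg_le_of_abs_le (abs_real_inner_le_norm ν N)
  have hle : inner ℝ N (ν + N) ≤ 0 := h _ <| by
    rw [inner_add_right, real_inner_self_eq_norm_sq, hν]
    linarith
  rw [inner_add_right, real_inner_self_eq_norm_sq, hN, real_inner_comm] at hle
  rw [← add_eq_zero_iff_eq_neg, ← norm_eq_zero, ← sq_eq_zero_iff]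
  refine le_antisymm ?_ (sq_nonneg _)
  rw [norm_add_sq_real, hν, hN, real_inner_comm]
  linarith

variable {E ι : Type*} [NormedAddCommGroup E] [InnerProductSpace ℝ E] [FiniteDimensional ℝ E]
  [Finite ι] (b : AffineBasis ι ℝ E)

theorem eventually_add_smul_mem_convexHull {i : ι} {x w : E} (hi : b.coord i x = 0)
    (hx : ∀ j, j ≠ i → 0 < b.coord j x) (hw : 0 ≤ inner ℝ (coordGrad b i) w) :
    ∀ᶠ t : ℝ in 𝓝[>] 0, x + t • w ∈ convexHull ℝ (range b) := by
  rw [b.convexHull_eq_nonneg_coord]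
  refine eventually_all.2 fun j => ?_
  obtain rfl | hj := eq_or_ne j i
  · filter_upwards [self_mem_nhdsWithin] with t ht
    rw [coord_add, hi, zero_add, real_inner_smul_right]
    exact mul_nonneg (le_of_lt ht) hw
  · have hcont : Continuous fun t : ℝ => b.coord j (x + t • w) :=
      (continuous_barycentric_coord b j).comp (by fun_prop)
    have hpos : ∀ᶠ t : ℝ in 𝓝 0, 0 < b.coord j (x + t • w) :=
      hcont.continuousAt.eventually (lt_mem_nhds (by simpa using hx j hj))
    exact (hpos.filter_mono nhdsWithin_le_nhds).mono fun t ht => le_of_lt ht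

theorem outerNormal_facet {m : ℕ} (b : AffineBasis ι ℝ (Space m)) {i : ι} {x : Space m}
    (hi : b.coord i x = 0) (hx : ∀ j, j ≠ i → 0 < b.coord j x) :
    outerNormal (convexHull ℝ (range b)) x = -facetNormal b i := by
  have hg : 0 < ‖coordGrad b i‖ := norm_pos_iff.2 (coordGrad_ne_zero b hi)
  refine outerNormal_eq_of_unique ⟨by rw [norm_neg, norm_facetNormal b hi], fun y hy => ?_⟩ ?_
  · rw [b.convexHull_eq_nonneg_coord] at hy
    rw [inner_neg_left, inner_facetNormal, inner_coordGrad_sub, hi, sub_zero, neg_nonpos]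
    exact mul_nonneg (inv_nonneg.2 hg.le) (hy i)
  · rintro N ⟨hN, hK⟩
    refine eq_neg_of_forall_inner_nonpos (norm_facetNormal b hi) hN fun w hw => ?_
    rw [inner_facetNormal] at hw
    obtain ⟨t, hmem, ht⟩ := ((eventually_add_smul_mem_convexHull b hi hx
      (nonneg_of_mul_nonneg_right hw (inv_pos.2 hg))).and self_mem_nhdsWithin).exists
    have hNt := hK (x + t • w) hmem
    rw [add_sub_cancel_left, real_inner_smul_right] at hNt
    exact nonpos_of_mul_nonpos_right hNt ht

end OuterNormal

noncomputable section HyperplaneCoordinates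

variable {E : Type*} [NormedAddCommGroup E] [InnerProductSpace ℝ E]

/-- The parametrization of space by the signed distance to the hyperplane through `p` with unit
normal `ν` and the position in that hyperplane. -/
def slabMap (p ν : E) (z : ℝ × (Submodule.span ℝ {ν})ᗮ) : E := z.1 • ν + z.2 + p

/-- The parametrization of the hyperplane through `p` with normal `ν` by its direction. -/
def planeMap (p ν : E) (w : (Submodule.span ℝ {ν})ᗮ) : E := w + p

/-- The oblique projection along `e` onto the hyperplane through `p` with normal `ν`. -/
def obliqueProj (p ν e x : E) : E := x - (inner ℝ ν (x - p) / inner ℝ ν e) • e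

theorem isometry_planeMap (p ν : E) : Isometry (planeMap p ν) :=
  Isometry.of_dist_eq fun x y => by simp [planeMap, Subtype.dist_eq]

theorem mem_range_planeMap {p ν x : E} (h : inner ℝ ν (x - p) = 0) : x ∈ range (planeMap p ν) :=
  ⟨⟨x - p, Submodule.mem_orthogonal_singleton_iff_inner_right.2 h⟩, by simp [planeMap]⟩

theorem continuous_obliqueProj (p ν e : E) : Continuous (obliqueProj p ν e) := by
  unfold obliqueProj
  fun_prop

theorem inner_slabMap_sub (p : E) {ν : E} (hν : ‖ν‖ = 1) (z : ℝ × (Submodule.span ℝ {ν})ᗮ) :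
    inner ℝ ν (slabMap p ν z - p) = z.1 := by
  rw [slabMap, add_sub_cancel_right, inner_add_right, real_inner_smul_right,
    real_inner_self_eq_norm_sq, hν, Submodule.mem_orthogonal_singleton_iff_inner_right.1 z.2.2]
  ring

theorem obliqueProj_add_smul (p : E) {ν e : E} (he : inner ℝ ν e ≠ 0) (x : E) (s : ℝ) :
    obliqueProj p ν e (x + s • e) = obliqueProj p ν e x := by
  rw [obliqueProj, obliqueProj, add_sub_right_comm x _ p, inner_add_right, real_inner_smul_right,
    add_div, mul_div_cancel_right₀ _ he, add_smul]
  abel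

theorem exists_obliqueProj_slabMap (p : E) {ν e : E} (hν : ‖ν‖ = 1) (he : inner ℝ ν e ≠ 0) :
    ∃ d : (Submodule.span ℝ {ν})ᗮ, ∀ z : ℝ × (Submodule.span ℝ {ν})ᗮ,
      obliqueProj p ν e (slabMap p ν z) = planeMap p ν (z.2 + z.1 • d) := by
  refine ⟨⟨ν - (inner ℝ ν e)⁻¹ • e, Submodule.mem_orthogonal_singleton_iff_inner_right.2 ?_⟩,
    fun z => ?_⟩
  · rw [inner_sub_right, real_inner_smul_right, inv_mul_cancel₀ he, real_inner_self_eq_norm_sq, hν]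
    norm_num
  · rw [obliqueProj, inner_slabMap_sub p hν, slabMap, planeMap, div_eq_mul_inv, mul_smul]
    simp only [Submodule.coe_add, Submodule.coe_smul, smul_sub]
    abel

theorem finrank_orthogonal_singleton [FiniteDimensional ℝ E] {ν : E} (hν : ‖ν‖ = 1) :
    Module.finrank ℝ (Submodule.span ℝ {ν})ᗮ = Module.finrank ℝ E - 1 := by
  have h := (Submodule.span ℝ {ν}).finrank_add_finrank_orthogonal
  rw [finrank_span_singleton (by rintro rfl; simp at hν)] at h
  omega

theorem volume_setOf_mul_add_mem_Icc {c : ℝ} (hc : c ≠ 0) (q : ℝ) :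
    volume {s : ℝ | s * c + q ∈ Icc 0 1} = ENNReal.ofReal |c⁻¹| := by
  have hset : {s : ℝ | s * c + q ∈ Icc 0 1} = (· * c) ⁻¹' Icc (-q) (1 - q) := by
    ext s
    simp only [mem_ofPred_eq, mem_Icc, mem_preimage]
    constructor <;> rintro ⟨h₀, h₁⟩ <;> constructor <;> linarith
  rw [hset, Real.volume_preimage_mul_right hc, Real.volume_Icc]
  simp

/-- The part, between the hyperplanes `⟪ν, x - p⟫ = 0` and `⟪ν, x - p⟫ = 1`, of the cylinder over
`A` in the direction `e`. -/
def obliqueCylinder (p ν e : E) (A : Set E) : Set E :=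
  {x | obliqueProj p ν e x ∈ A ∧ inner ℝ ν (x - p) ∈ Icc (0 : ℝ) 1}

variable [MeasurableSpace E] [BorelSpace E]

theorem measurableSet_obliqueCylinder (p ν e : E) {A : Set E} (hA : MeasurableSet A) :
    MeasurableSet (obliqueCylinder p ν e A) :=
  ((continuous_obliqueProj p ν e).measurable hA).inter
    (measurableSet_Icc.preimage (by fun_prop : Measurable fun x : E => inner ℝ ν (x - p)))

variable [FiniteDimensional ℝ E]

theorem measurePreserving_slabMap (p : E) {ν : E} (hν : ‖ν‖ = 1) :
    MeasurePreserving (slabMap p ν) (volume.prod volume) volume := by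
  have hsplit := ((Submodule.span ℝ {ν}).measurePreserving_measurableEquivProd p).symm
  rw [InnerProductSpace.euclideanHausdorffMeasure_eq_volume] at hsplit
  have hline : MeasurePreserving (LinearIsometryEquiv.toSpanUnitSingleton (𝕜 := ℝ) ν hν)
      volume volume := LinearIsometryEquiv.measurePreserving _
  have hslab : slabMap p ν = ((Submodule.span ℝ {ν}).measurableEquivProd p).symm ∘
      Prod.map (LinearIsometryEquiv.toSpanUnitSingleton (𝕜 := ℝ) ν hν) id := by
    funext z
    simp [slabMap]
  rw [hslab]
  exact hsplit.comp (hline.prod (MeasurePreserving.id volume))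

theorem measurableEmbedding_slabMap (p : E) {ν : E} (hν : ‖ν‖ = 1) :
    MeasurableEmbedding (slabMap p ν) := by
  refine (measurePreserving_slabMap p hν).measurable.measurableEmbedding fun y z hyz => ?_
  have hfst : y.1 = z.1 := by rw [← inner_slabMap_sub p hν y, hyz, inner_slabMap_sub p hν z]
  exact Prod.ext hfst (Subtype.ext (by simpa [slabMap, hfst] using hyz))

theorem integral_eq_integral_lines {e : E} (he : ‖e‖ = 1) {G : E → ℝ} (hG : Integrable G) :
    ∫ x, G x = ∫ z : (Submodule.span ℝ {e})ᗮ, ∫ s : ℝ, G (z + s • e) := by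
  have hslab := measurePreserving_slabMap 0 he
  have hemb := measurableEmbedding_slabMap 0 he
  have hprod : Integrable (fun y => G (slabMap 0 e y)) (volume.prod volume) :=
    (hslab.integrable_comp_emb hemb).2 hG
  rw [← hslab.integral_comp hemb, integral_prod_symm _ hprod]
  simp only [slabMap, add_zero, add_comm]

theorem euclideanHausdorffMeasure_restrict_eq_map_planeMap {p ν : E} (hν : ‖ν‖ = 1) {A : Set E}
    (hA : MeasurableSet A) (h : ∀ x ∈ A, inner ℝ ν (x - p) = 0) :
    (Measure.euclideanHausdorffMeasure (Module.finrank ℝ E - 1)).restrict A =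
      (Measure.map (planeMap p ν) volume).restrict A := by
  have hsub : A ⊆ range (planeMap p ν) := fun x hx => mem_range_planeMap (h x hx)
  rw [← InnerProductSpace.euclideanHausdorffMeasure_eq_volume, finrank_orthogonal_singleton hν,
    (isometry_planeMap p ν).map_euclideanHausdorffMeasure, Measure.restrict_restrict hA,
    inter_eq_left.2 hsub]

theorem volume_obliqueCylinder_eq_planeMap (p : E) {ν e : E} (hν : ‖ν‖ = 1)
    (hνe : inner ℝ ν e ≠ 0) {A : Set E} (hA : MeasurableSet A) :
    volume (obliqueCylinder p ν e A) = volume (planeMap p ν ⁻¹' A) := by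
  obtain ⟨d, hd⟩ := exists_obliqueProj_slabMap p hν hνe
  have hS := measurableSet_obliqueCylinder p ν e hA
  have hslice : ∀ s : ℝ, volume (Prod.mk s ⁻¹' (slabMap p ν ⁻¹' obliqueCylinder p ν e A)) =
      (Icc (0 : ℝ) 1).indicator (fun _ => volume (planeMap p ν ⁻¹' A)) s := by
    intro s
    by_cases hs : s ∈ Icc (0 : ℝ) 1
    · rw [indicator_of_mem hs, ← measure_preimage_add_right volume (s • d) (planeMap p ν ⁻¹' A)]
      congr 1 with w
      simp [obliqueCylinder, hd, inner_slabMap_sub p hν, -mem_Icc, hs]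
    · rw [indicator_of_notMem hs]
      convert measure_empty (μ := (volume : Measure (Submodule.span ℝ {ν})ᗮ))
      ext w
      simp [obliqueCylinder, inner_slabMap_sub p hν, -mem_Icc, hs]
  have hslab := measurePreserving_slabMap p hν
  rw [← hslab.measure_preimage hS.nullMeasurableSet, Measure.prod_apply (hslab.measurable hS)]
  simp_rw [hslice]
  rw [lintegral_indicator_const measurableSet_Icc, Real.volume_Icc]
  simp

theorem volume_obliqueCylinder_eq_obliqueProj (p : E) {ν e : E} (he : ‖e‖ = 1)
    (hνe : inner ℝ ν e ≠ 0) {A : Set E} (hA : MeasurableSet A) :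
    volume (obliqueCylinder p ν e A) = ENNReal.ofReal |(inner ℝ ν e)⁻¹| *
      volume ((fun z : (Submodule.span ℝ {e})ᗮ => obliqueProj p ν e z) ⁻¹' A) := by
  have hS := measurableSet_obliqueCylinder p ν e hA
  set γ : (Submodule.span ℝ {e})ᗮ → E := fun z => obliqueProj p ν e z
  have hslab : ∀ (s : ℝ) (z : (Submodule.span ℝ {e})ᗮ), slabMap 0 e (s, z) = (z : E) + s • e :=
    fun s z => by rw [slabMap, add_zero, add_comm]
  have hslice : ∀ z, volume ((fun s => (s, z)) ⁻¹' (slabMap 0 e ⁻¹' obliqueCylinder p ν e A)) =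
      (γ ⁻¹' A).indicator (fun _ => ENNReal.ofReal |(inner ℝ ν e)⁻¹|) z := by
    intro z
    have hmem : ∀ s : ℝ, slabMap 0 e (s, z) ∈ obliqueCylinder p ν e A ↔
        γ z ∈ A ∧ s * inner ℝ ν e + inner ℝ ν ((z : E) - p) ∈ Icc (0 : ℝ) 1 := by
      intro s
      rw [hslab, obliqueCylinder, mem_ofPred_eq, obliqueProj_add_smul p hνe, add_sub_right_comm,
        inner_add_right, real_inner_smul_right, add_comm (inner ℝ ν ((z : E) - p))]
    by_cases hz : z ∈ γ ⁻¹' A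
    · rw [indicator_of_mem hz, ← volume_setOf_mul_add_mem_Icc hνe (inner ℝ ν ((z : E) - p))]
      congr 1 with s
      exact (hmem s).trans (and_iff_right hz)
    · rw [indicator_of_notMem hz]
      convert measure_empty (μ := (volume : Measure ℝ))
      exact eq_empty_of_forall_notMem fun s hs => hz ((hmem s).1 hs).1
  have hmp := measurePreserving_slabMap (0 : E) he
  rw [← hmp.measure_preimage hS.nullMeasurableSet, Measure.prod_apply_symm (hmp.measurable hS)]
  simp_rw [hslice]
  refine lintegral_indicator_const (hA.preimage ?_) _
  exact ((continuous_obliqueProj p ν e).comp continuous_subtype_val).measurable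

theorem map_obliqueProj (p : E) {ν e : E} (hν : ‖ν‖ = 1) (he : ‖e‖ = 1) (hνe : inner ℝ ν e ≠ 0) :
    Measure.map (fun z : (Submodule.span ℝ {e})ᗮ => obliqueProj p ν e z) volume =
      ENNReal.ofReal |inner ℝ ν e| • Measure.map (planeMap p ν) volume := by
  have hγ : Measurable fun z : (Submodule.span ℝ {e})ᗮ => obliqueProj p ν e z :=
    ((continuous_obliqueProj p ν e).comp continuous_subtype_val).measurable
  ext A hA
  rw [Measure.map_apply hγ hA,
    Measure.smul_apply, Measure.map_apply (isometry_planeMap p ν).continuous.measurable hA,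
    ← volume_obliqueCylinder_eq_planeMap p hν hνe hA,
    volume_obliqueCylinder_eq_obliqueProj p he hνe hA, smul_eq_mul, ← mul_assoc,
    ← ENNReal.ofReal_mul (abs_nonneg _), ← abs_mul, mul_inv_cancel₀ hνe, abs_one,
    ENNReal.ofReal_one, one_mul]

end HyperplaneCoordinates

section FacetMeasure

variable {m : ℕ} {ι : Type*} (b : AffineBasis ι ℝ (Space m))

theorem surf_facet {i : ι} {p : Space m} (hp : b.coord i p = 0) :
    surf (facet b i) =
      (Measure.map (planeMap p (facetNormal b i)) volume).restrict (facet b i) := by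
  rw [← euclideanHausdorffMeasure_restrict_eq_map_planeMap (norm_facetNormal b hp)
    (isClosed_facet b i).measurableSet fun _ hx => inner_facetNormal_sub_eq_zero b hx.2 hp,
    finrank_euclideanSpace, Fintype.card_fin]

theorem volume_setOf_coord_planeMap_eq_zero {i j : ι} (hij : j ≠ i) {p : Space m}
    (hp : b.coord i p = 0) :
    volume {w | b.coord j (planeMap p (facetNormal b i) w) = 0} = 0 := by
  set ν := facetNormal b i
  let f : (Submodule.span ℝ {ν})ᗮ →ᵃ[ℝ] ℝ := (b.coord j).comp
    ((Submodule.span ℝ {ν})ᗮ.subtype.toAffineMap + AffineMap.const ℝ _ p)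
  have hf : ∀ w, f w = b.coord j (planeMap p ν w) := fun w => by simp [f, planeMap]
  have hset : {w | b.coord j (planeMap p ν w) = 0} =
      ((AffineSubspace.mk' (0 : ℝ) ⊥).comap f : Set _) := by
    ext w
    simp [hf, AffineSubspace.mem_mk']
  rw [hset]
  apply Measure.addHaar_affineSubspace
  intro htop
  obtain ⟨w, hw⟩ : b j ∈ range (planeMap p ν) :=
    mem_range_planeMap (inner_facetNormal_sub_eq_zero b (b.coord_apply_ne hij.symm) hp)
  have hmem : w ∈ (AffineSubspace.mk' (0 : ℝ) ⊥).comap f := htop ▸ AffineSubspace.mem_top _ _ _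
  rw [AffineSubspace.mem_comap, AffineSubspace.mem_mk', hf, hw, b.coord_apply_eq] at hmem
  simp at hmem

theorem ae_coord_ne_zero_surf_facet {i j : ι} (hij : j ≠ i) :
    ∀ᵐ x ∂surf (facet b i), b.coord j x ≠ 0 := by
  obtain hempty | ⟨p, hp⟩ := (facet b i).eq_empty_or_nonempty
  · simp [hempty]
  rw [surf_facet b hp.2]
  refine ae_restrict_of_ae ?_
  rw [ae_map_iff (isometry_planeMap _ _).continuous.aemeasurable, ae_iff]
  · simpa using volume_setOf_coord_planeMap_eq_zero b hij hp.2
  · exact ((continuous_barycentric_coord b j).measurable (measurableSet_singleton 0)).compl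

theorem isFiniteMeasure_surf_facet [Finite ι] (i : ι) : IsFiniteMeasure (surf (facet b i)) := by
  obtain hempty | ⟨p, hp⟩ := (facet b i).eq_empty_or_nonempty
  · rw [hempty, surf, Measure.restrict_empty]
    infer_instance
  have hplane := isometry_planeMap p (facetNormal b i)
  rw [surf_facet b hp.2, isFiniteMeasure_restrict,
    Measure.map_apply hplane.continuous.measurable (isClosed_facet b i).measurableSet]
  exact (hplane.isClosedEmbedding.isCompact_preimage (isCompact_facet b i)).measure_lt_top.ne

theorem outerNormal_ae_facet [Finite ι] (i : ι) :
    ∀ᵐ x ∂surf (facet b i), outerNormal (convexHull ℝ (range b)) x = -facetNormal b i := by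
  have hne : ∀ᵐ x ∂surf (facet b i), ∀ j, j ≠ i → b.coord j x ≠ 0 := by
    refine ae_all_iff.2 fun j => ?_
    obtain rfl | hj := eq_or_ne j i
    · simp
    · filter_upwards [ae_coord_ne_zero_surf_facet b hj] with x hx _ using hx
  filter_upwards [hne, ae_restrict_mem (isClosed_facet b i).measurableSet] with x hx hxf
  exact outerNormal_facet b hxf.2 fun j hj => (hxf.1 j).lt_of_ne' (hx j hj)

theorem surf_frontier_convexHull [Finite ι] :
    surf (frontier (convexHull ℝ (range b))) = Measure.sum fun i => surf (facet b i) := by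
  rw [surf, frontier_convexHull_range]
  refine Measure.restrict_iUnion_ae (fun i j hij => ?_)
    fun i => (isClosed_facet b i).measurableSet.nullMeasurableSet
  have hne := ae_coord_ne_zero_surf_facet b hij.symm
  rw [surf, ae_restrict_iff' (isClosed_facet b i).measurableSet, ae_iff] at hne
  refine measure_mono_null ?_ hne
  rintro x ⟨hi, hj⟩
  simp [hi, hj.2]

theorem aestronglyMeasurable_outerNormal_convexHull [Finite ι] :
    AEStronglyMeasurable (outerNormal (convexHull ℝ (range b)))
      (surf (frontier (convexHull ℝ (range b)))) := by
  rw [surf_frontier_convexHull, aestronglyMeasurable_sum_measure_iff]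
  exact fun i => aestronglyMeasurable_const.congr (EventuallyEq.symm (outerNormal_ae_facet b i))

theorem integrable_mul_inner_outerNormal_convexHull [Finite ι] {F : Space m → ℝ}
    (hF : Integrable F (surf (frontier (convexHull ℝ (range b))))) (a : Space m) :
    Integrable (fun x => F x * inner ℝ (outerNormal (convexHull ℝ (range b)) x) a)
      (surf (frontier (convexHull ℝ (range b)))) := by
  refine hF.mul_bdd (c := ‖a‖)
    ((aestronglyMeasurable_outerNormal_convexHull b).inner aestronglyMeasurable_const)
    (Eventually.of_forall fun x => (norm_inner_le_norm _ _).trans ?_)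
  exact mul_le_of_le_one_left (norm_nonneg _) (norm_outerNormal_le _ _)

theorem integral_mul_inner_outerNormal_convexHull [Fintype ι] {F : Space m → ℝ}
    (hF : Integrable F (surf (frontier (convexHull ℝ (range b))))) (a : Space m) :
    ∫ x, F x * inner ℝ (outerNormal (convexHull ℝ (range b)) x) a
        ∂surf (frontier (convexHull ℝ (range b))) =
      -∑ i, inner ℝ (facetNormal b i) a * ∫ x, F x ∂surf (facet b i) := by
  have hint := integrable_mul_inner_outerNormal_convexHull b hF a
  rw [surf_frontier_convexHull] at hint ⊢
  rw [integral_sum_measure hint, tsum_fintype, ← Finset.sum_neg_distrib]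
  refine Finset.sum_congr rfl fun i _ => ?_
  rw [← integral_const_mul, ← integral_neg]
  refine integral_congr_ae ?_
  filter_upwards [outerNormal_ae_facet b i] with x hx
  rw [hx, inner_neg_left]
  ring

end FacetMeasure

noncomputable section GaussGreen

variable {m : ℕ} {ι : Type*}

/-- The projection along `e` onto the hyperplane that contains the facet opposite to `b i`. -/
def facetProj (b : AffineBasis ι ℝ (Space m)) (i : ι) (e x : Space m) : Space m :=
  x - (b.coord i x / inner ℝ (coordGrad b i) e) • e

variable (b : AffineBasis ι ℝ (Space m)) {e : Space m}

theorem coord_facetProj (i j : ι) (x : Space m) : b.coord j (facetProj b i e x) =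
    b.coord j x - b.coord i x / inner ℝ (coordGrad b i) e * inner ℝ (coordGrad b j) e := by
  rw [facetProj, sub_eq_add_neg, coord_add, inner_neg_right, real_inner_smul_right,
    ← sub_eq_add_neg]

theorem continuous_facetProj (i : ι) : Continuous (facetProj b i e) := by
  have := continuous_barycentric_coord b i
  unfold facetProj
  fun_prop

theorem obliqueProj_facetNormal {i : ι} {p : Space m} (hp : b.coord i p = 0) (x : Space m) :
    obliqueProj p (facetNormal b i) e x = facetProj b i e x := by
  rw [obliqueProj, facetProj, inner_facetNormal, inner_facetNormal, inner_coordGrad_sub, hp,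
    sub_zero, mul_div_mul_left]
  exact inv_ne_zero (norm_ne_zero_iff.2 (coordGrad_ne_zero b hp))

theorem smul_surf_facet (he : ‖e‖ = 1) {i : ι} (hie : inner ℝ (coordGrad b i) e ≠ 0) :
    ENNReal.ofReal |inner ℝ (facetNormal b i) e| • surf (facet b i) =
      Measure.map (fun z : (Submodule.span ℝ {e})ᗮ => facetProj b i e z)
        (volume.restrict
          ((fun z : (Submodule.span ℝ {e})ᗮ => facetProj b i e z) ⁻¹' facet b i)) := by
  obtain hempty | ⟨p, hp⟩ := (facet b i).eq_empty_or_nonempty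
  · simp [hempty]
  have hνe : inner ℝ (facetNormal b i) e ≠ 0 := by
    rw [inner_facetNormal]
    exact mul_ne_zero (inv_ne_zero (norm_ne_zero_iff.2 (coordGrad_ne_zero b hp.2))) hie
  have hproj : Continuous fun z : (Submodule.span ℝ {e})ᗮ => facetProj b i e z :=
    (continuous_facetProj b i).comp continuous_subtype_val
  rw [surf_facet b hp.2, ← Measure.restrict_smul,
    ← map_obliqueProj p (norm_facetNormal b hp.2) he hνe]
  simp_rw [obliqueProj_facetNormal b hp.2]
  exact Measure.restrict_map hproj.measurable (isClosed_facet b i).measurableSet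

theorem integrable_surf_facet_of_continuous [Finite ι] (i : ι) {F : Space m → ℝ}
    (hF : Continuous F) : Integrable F (surf (facet b i)) := by
  have := isFiniteMeasure_surf_facet b i
  have hcont := hF.continuousOn.integrableOn_compact (μ := surf (facet b i)) (isCompact_facet b i)
  rwa [IntegrableOn, Measure.restrict_restrict (isClosed_facet b i).measurableSet,
    inter_self] at hcont

theorem integrableOn_facetProj [Finite ι] (he : ‖e‖ = 1) {i : ι}
    (hie : inner ℝ (coordGrad b i) e ≠ 0) {F : Space m → ℝ} (hF : Continuous F) :
    IntegrableOn (fun z : (Submodule.span ℝ {e})ᗮ => F (facetProj b i e z))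
      ((fun z : (Submodule.span ℝ {e})ᗮ => facetProj b i e z) ⁻¹' facet b i) := by
  have hproj : Continuous fun z : (Submodule.span ℝ {e})ᗮ => facetProj b i e z :=
    (continuous_facetProj b i).comp continuous_subtype_val
  have hint := (integrable_surf_facet_of_continuous b i hF).smul_measure
    (ENNReal.ofReal_ne_top (r := |inner ℝ (facetNormal b i) e|))
  rw [smul_surf_facet b he hie] at hint
  exact (integrable_map_measure hF.aestronglyMeasurable hproj.aemeasurable).1 hint

theorem setIntegral_facetProj (he : ‖e‖ = 1) {i : ι}
    (hie : inner ℝ (coordGrad b i) e ≠ 0) {F : Space m → ℝ} (hF : Continuous F) :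
    ∫ z in (fun z : (Submodule.span ℝ {e})ᗮ => facetProj b i e z) ⁻¹' facet b i,
        F (facetProj b i e z) =
      |inner ℝ (facetNormal b i) e| * ∫ x, F x ∂surf (facet b i) := by
  have hproj : Continuous fun z : (Submodule.span ℝ {e})ᗮ => facetProj b i e z :=
    (continuous_facetProj b i).comp continuous_subtype_val
  rw [← integral_map (f := F) hproj.aemeasurable hF.aestronglyMeasurable,
    ← smul_surf_facet b he hie, integral_smul_measure, ENNReal.toReal_ofReal (abs_nonneg _),
    smul_eq_mul]

/-- `e` is the unit vector that points from the vertex `b k` to the vertex `b l` at distance `κ⁻¹`: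
along `e`, the barycentric coordinate of `b k` falls and that of `b l` grows, both at the rate `κ`,
and the other ones are constant. -/
structure IsEdgeDirection (b : AffineBasis ι ℝ (Space m)) (k l : ι) (κ : ℝ) (e : Space m) :
    Prop where
  norm_eq_one : ‖e‖ = 1
  rate_pos : 0 < κ
  inner_source : inner ℝ (coordGrad b k) e = -κ
  inner_target : inner ℝ (coordGrad b l) e = κ
  inner_of_ne : ∀ j, j ≠ k → j ≠ l → inner ℝ (coordGrad b j) e = 0

theorem isEdgeDirection_normalize {k l : ι} (hkl : k ≠ l) :
    IsEdgeDirection b k l ‖b l - b k‖⁻¹ (‖b l - b k‖⁻¹ • (b l - b k)) := by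
  have hpos : 0 < ‖b l - b k‖ := norm_pos_iff.2 (sub_ne_zero.2 (b.ind.injective.ne hkl.symm))
  refine ⟨norm_smul_inv_norm (𝕜 := ℝ) (norm_pos_iff.1 hpos), inv_pos.2 hpos, ?_, ?_,
    fun j hk hl => ?_⟩ <;> rw [real_inner_smul_right, inner_coordGrad_sub]
  · simp [b.coord_apply_ne hkl]
  · simp [b.coord_apply_ne hkl.symm]
  · simp [b.coord_apply_ne hk, b.coord_apply_ne hl]

variable {b} {k l : ι} {κ : ℝ}

theorem IsEdgeDirection.add_smul_mem_convexHull_iff (h : IsEdgeDirection b k l κ e) (z : Space m)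
    (s : ℝ) : z + s • e ∈ convexHull ℝ (range b) ↔
      (∀ j, j ≠ k → j ≠ l → 0 ≤ b.coord j z) ∧
        s ∈ Icc (-(b.coord l z / κ)) (b.coord k z / κ) := by
  have hsource : b.coord k (z + s • e) = b.coord k z - s * κ := by
    rw [coord_add, real_inner_smul_right, h.inner_source]; ring
  have htarget : b.coord l (z + s • e) = b.coord l z + s * κ := by
    rw [coord_add, real_inner_smul_right, h.inner_target]
  have hother : ∀ j, j ≠ k → j ≠ l → b.coord j (z + s • e) = b.coord j z := fun j hk hl => by
    rw [coord_add, real_inner_smul_right, h.inner_of_ne j hk hl, mul_zero, add_zero]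
  rw [b.convexHull_eq_nonneg_coord, mem_ofPred_eq, mem_Icc, ← neg_div, div_le_iff₀ h.rate_pos,
    le_div_iff₀ h.rate_pos]
  constructor
  · refine fun hs => ⟨fun j hk hl => hother j hk hl ▸ hs j, ?_, ?_⟩
    · linarith [htarget ▸ hs l]
    · linarith [hsource ▸ hs k]
  · rintro ⟨hne, hl, hk⟩ j
    obtain rfl | hjk := eq_or_ne j k
    · rw [hsource]; linarith
    obtain rfl | hjl := eq_or_ne j l
    · rw [htarget]; linarith
    exact hother j hjk hjl ▸ hne j hjk hjl

theorem facetProj_mem_facet_iff {i : ι} (hie : inner ℝ (coordGrad b i) e ≠ 0) (z : Space m) :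
    facetProj b i e z ∈ facet b i ↔ facetProj b i e z ∈ convexHull ℝ (range b) := by
  rw [b.convexHull_eq_nonneg_coord, facet, mem_ofPred_eq, mem_ofPred_eq, and_iff_left]
  rw [coord_facetProj, div_mul_cancel₀ _ hie, sub_self]

theorem IsEdgeDirection.facetProj_source (h : IsEdgeDirection b k l κ e) (z : Space m) :
    facetProj b k e z = z + (b.coord k z / κ) • e := by
  rw [facetProj, h.inner_source, div_neg, neg_smul, sub_neg_eq_add]

theorem IsEdgeDirection.facetProj_target (h : IsEdgeDirection b k l κ e) (z : Space m) :
    facetProj b l e z = z + (-(b.coord l z / κ)) • e := by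
  rw [facetProj, h.inner_target, neg_smul, ← sub_eq_add_neg]

theorem IsEdgeDirection.inner_source_ne_zero (h : IsEdgeDirection b k l κ e) :
    inner ℝ (coordGrad b k) e ≠ 0 :=
  h.inner_source ▸ neg_ne_zero.2 h.rate_pos.ne'

theorem IsEdgeDirection.inner_target_ne_zero (h : IsEdgeDirection b k l κ e) :
    inner ℝ (coordGrad b l) e ≠ 0 :=
  h.inner_target ▸ h.rate_pos.ne'

theorem IsEdgeDirection.facetProj_source_mem_facet_iff (h : IsEdgeDirection b k l κ e)
    (z : Space m) : facetProj b k e z ∈ facet b k ↔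
      (∀ j, j ≠ k → j ≠ l → 0 ≤ b.coord j z) ∧ -(b.coord l z / κ) ≤ b.coord k z / κ := by
  rw [facetProj_mem_facet_iff h.inner_source_ne_zero, h.facetProj_source,
    h.add_smul_mem_convexHull_iff, right_mem_Icc]

theorem IsEdgeDirection.facetProj_target_mem_facet_iff (h : IsEdgeDirection b k l κ e)
    (z : Space m) : facetProj b l e z ∈ facet b l ↔ facetProj b k e z ∈ facet b k := by
  rw [facetProj_mem_facet_iff h.inner_target_ne_zero, h.facetProj_target,
    h.add_smul_mem_convexHull_iff, left_mem_Icc, h.facetProj_source_mem_facet_iff]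

theorem IsEdgeDirection.sum_inner_facetNormal_mul [Fintype ι] (h : IsEdgeDirection b k l κ e)
    (hkl : k ≠ l) (c : ι → ℝ) : ∑ i, inner ℝ (facetNormal b i) e * c i =
      |inner ℝ (facetNormal b l) e| * c l - |inner ℝ (facetNormal b k) e| * c k := by
  have hnonneg (i : ι) : 0 ≤ ‖coordGrad b i‖⁻¹ * κ :=
    mul_nonneg (inv_nonneg.2 (norm_nonneg _)) h.rate_pos.le
  rw [Fintype.sum_eq_add k l hkl fun i hi => by
      rw [inner_facetNormal, h.inner_of_ne i hi.1 hi.2, mul_zero, zero_mul],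
    inner_facetNormal, inner_facetNormal, h.inner_source, h.inner_target, mul_neg, abs_neg,
    abs_of_nonneg (hnonneg k), abs_of_nonneg (hnonneg l)]
  ring

theorem IsEdgeDirection.integral_line_fderiv (h : IsEdgeDirection b k l κ e) {F : Space m → ℝ}
    (hF : ContDiff ℝ 1 F) (z : Space m) :
    ∫ s : ℝ, (convexHull ℝ (range b)).indicator (fun x => fderiv ℝ F x e) (z + s • e) =
      {z | facetProj b k e z ∈ facet b k}.indicator
        (fun z => F (facetProj b k e z) - F (facetProj b l e z)) z := by
  have hmem := h.add_smul_mem_convexHull_iff z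
  by_cases hz : facetProj b k e z ∈ facet b k
  · have ⟨hne, hle⟩ := (h.facetProj_source_mem_facet_iff z).1 hz
    have hmem_Icc (s : ℝ) : z + s • e ∈ convexHull ℝ (range b) ↔
        s ∈ Icc (-(b.coord l z / κ)) (b.coord k z / κ) := (hmem s).trans (and_iff_right hne)
    have hline : (fun s : ℝ => (convexHull ℝ (range b)).indicator (fun x => fderiv ℝ F x e)
        (z + s • e)) = (Icc (-(b.coord l z / κ)) (b.coord k z / κ)).indicator
          fun s : ℝ => fderiv ℝ F (z + s • e) e := by
      ext s
      simp only [indicator, hmem_Icc]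
    have hderiv : ∀ s : ℝ,
        HasDerivAt (fun s : ℝ => F (z + s • e)) (fderiv ℝ F (z + s • e) e) s := by
      intro s
      have hz_add : HasDerivAt (fun s : ℝ => z + s • e) e s := by
        simpa using ((hasDerivAt_id s).smul_const e).const_add z
      exact (hF.differentiable one_ne_zero _).hasFDerivAt.comp_hasDerivAt s hz_add
    have hcont : Continuous fun s : ℝ => fderiv ℝ F (z + s • e) e :=
      ((hF.continuous_fderiv one_ne_zero).comp (by fun_prop)).clm_apply continuous_const
    rw [indicator_of_mem (by exact hz), hline, integral_indicator measurableSet_Icc,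
      integral_Icc_eq_integral_Ioc, ← intervalIntegral.integral_of_le hle,
      intervalIntegral.integral_eq_sub_of_hasDerivAt (fun s _ => hderiv s)
        (hcont.intervalIntegrable _ _), h.facetProj_source, h.facetProj_target]
  · have hempty : ∀ s : ℝ, z + s • e ∉ convexHull ℝ (range b) := fun s hs =>
      hz ((h.facetProj_source_mem_facet_iff z).2 ⟨((hmem s).1 hs).1, nonempty_Icc.1
        ⟨s, ((hmem s).1 hs).2⟩⟩)
    rw [indicator_of_notMem (by exact hz)]
    simp [hempty]

theorem IsEdgeDirection.setIntegral_fderiv [Fintype ι] (h : IsEdgeDirection b k l κ e)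
    (hkl : k ≠ l) {F : Space m → ℝ} (hF : ContDiff ℝ 1 F) :
    ∫ x in convexHull ℝ (range b), fderiv ℝ F x e =
      -∑ i, inner ℝ (facetNormal b i) e * ∫ x, F x ∂surf (facet b i) := by
  have hK := isCompact_convexHull_range b
  have hG : Integrable ((convexHull ℝ (range b)).indicator fun x => fderiv ℝ F x e) :=
    (((hF.continuous_fderiv one_ne_zero).clm_apply
      continuous_const).continuousOn.integrableOn_compact hK).integrable_indicator hK.measurableSet
  have hD : ((fun z : (Submodule.span ℝ {e})ᗮ => facetProj b l e z) ⁻¹' facet b l) =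
      (fun z : (Submodule.span ℝ {e})ᗮ => facetProj b k e z) ⁻¹' facet b k := by
    ext z
    exact h.facetProj_target_mem_facet_iff z
  have hDmeas : MeasurableSet
      ((fun z : (Submodule.span ℝ {e})ᗮ => facetProj b k e z) ⁻¹' facet b k) :=
    ((isClosed_facet b k).preimage
      ((continuous_facetProj b k).comp continuous_subtype_val)).measurableSet
  have hsource := integrableOn_facetProj b h.norm_eq_one h.inner_source_ne_zero hF.continuous
  have htarget := integrableOn_facetProj b h.norm_eq_one h.inner_target_ne_zero hF.continuous
  rw [hD] at htarget
  calc ∫ x in convexHull ℝ (range b), fderiv ℝ F x e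
      = ∫ z : (Submodule.span ℝ {e})ᗮ, ∫ s : ℝ,
          (convexHull ℝ (range b)).indicator (fun x => fderiv ℝ F x e) (z + s • e) := by
        rw [← integral_indicator hK.measurableSet, integral_eq_integral_lines h.norm_eq_one hG]
    _ = ∫ z in (fun z : (Submodule.span ℝ {e})ᗮ => facetProj b k e z) ⁻¹' facet b k,
          (F (facetProj b k e z) - F (facetProj b l e z)) := by
        simp_rw [h.integral_line_fderiv hF]
        exact integral_indicator hDmeas
    _ = |inner ℝ (facetNormal b k) e| * (∫ x, F x ∂surf (facet b k)) -
          |inner ℝ (facetNormal b l) e| * ∫ x, F x ∂surf (facet b l) := by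
        rw [integral_sub hsource htarget,
          setIntegral_facetProj b h.norm_eq_one h.inner_source_ne_zero hF.continuous, ← hD,
          setIntegral_facetProj b h.norm_eq_one h.inner_target_ne_zero hF.continuous]
    _ = -∑ i, inner ℝ (facetNormal b i) e * ∫ x, F x ∂surf (facet b i) := by
        rw [h.sum_inner_facetNormal_mul hkl, neg_sub]

theorem integrable_surf_frontier_of_continuous [Finite ι] (b : AffineBasis ι ℝ (Space m))
    {F : Space m → ℝ} (hF : Continuous F) :
    Integrable F (surf (frontier (convexHull ℝ (range b)))) := by
  have := Fintype.ofFinite ι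
  rw [surf_frontier_convexHull, Measure.sum_fintype]
  exact integrable_finsetSum_measure.2 fun i _ => integrable_surf_facet_of_continuous b i hF

theorem setIntegral_fderiv_convexHull [Finite ι] (b : AffineBasis ι ℝ (Space m))
    {F : Space m → ℝ} (hF : ContDiff ℝ 1 F) (a : Space m) :
    ∫ x in convexHull ℝ (range b), fderiv ℝ F x a =
      ∫ x, F x * inner ℝ (outerNormal (convexHull ℝ (range b)) x) a
        ∂surf (frontier (convexHull ℝ (range b))) := by
  have := Fintype.ofFinite ι
  have hint (a : Space m) : IntegrableOn (fun x => fderiv ℝ F x a) (convexHull ℝ (range b)) :=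
    ((hF.continuous_fderiv one_ne_zero).clm_apply
      continuous_const).continuousOn.integrableOn_compact (isCompact_convexHull_range b)
  rw [integral_mul_inner_outerNormal_convexHull b
    (integrable_surf_frontier_of_continuous b hF.continuous)]
  -- Both sides are linear in `a`, and the edges that start at a given vertex span the space.
  obtain ⟨k⟩ := b.nonempty
  have ha : a ∈ Submodule.span ℝ (range fun l => b l - b k) := by
    have := vectorSpan_range_eq_span_range_vsub_right ℝ b k
    rw [← direction_affineSpan, b.tot, AffineSubspace.direction_top] at this
    exact this ▸ Submodule.mem_top
  induction ha using Submodule.span_induction with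
  | mem w hw =>
    obtain ⟨l, rfl⟩ := hw
    obtain rfl | hkl := eq_or_ne k l
    · simp
    have hpos : ‖b l - b k‖ ≠ 0 := norm_ne_zero_iff.2 (sub_ne_zero.2 (b.ind.injective.ne hkl.symm))
    have hedge := (isEdgeDirection_normalize b hkl).setIntegral_fderiv hkl hF
    simp only [map_smul, smul_eq_mul, real_inner_smul_right, mul_assoc, integral_const_mul,
      ← Finset.mul_sum, ← mul_neg] at hedge
    exact mul_left_cancel₀ (inv_ne_zero hpos) hedge
  | zero => simp
  | add v w _ _ hv hw =>
    simp only [map_add, inner_add_right, add_mul, Finset.sum_add_distrib]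
    rw [integral_add (hint v) (hint w), hv, hw, neg_add]
  | smul c v _ hv =>
    simp only [map_smul, smul_eq_mul, real_inner_smul_right, mul_assoc, integral_const_mul,
      ← Finset.mul_sum, hv, mul_neg]

end GaussGreen

section SquareIntegrable

variable {α : Type*} {_ : MeasurableSpace α} {μ : Measure α}

theorem inner_toLp {f g : α → ℝ} (hf : MemLp f 2 μ) (hg : MemLp g 2 μ) :
    inner ℝ (hf.toLp f) (hg.toLp g) = ∫ x, f x * g x ∂μ := by
  rw [L2.inner_def]
  refine integral_congr_ae ?_
  filter_upwards [hf.coeFn_toLp, hg.coeFn_toLp] with x hfx hgx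
  rw [hfx, hgx, RCLike.inner_apply, conj_trivial, mul_comm]

theorem dist_toLp_sq {f g : α → ℝ} (hf : MemLp f 2 μ) (hg : MemLp g 2 μ) :
    dist (hf.toLp f) (hg.toLp g) ^ 2 = ∫ x, (f x - g x) ^ 2 ∂μ := by
  rw [dist_eq_norm, ← MemLp.toLp_sub hf hg, ← real_inner_self_eq_norm_sq, inner_toLp]
  simp only [Pi.sub_apply, pow_two]

theorem tendsto_integral_mul {f g : ℕ → α → ℝ} {F G : α → ℝ} (hf : ∀ k, MemLp (f k) 2 μ)
    (hg : ∀ k, MemLp (g k) 2 μ) (hF : MemLp F 2 μ) (hG : MemLp G 2 μ)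
    (hfF : Tendsto (fun k => eLpNorm (fun x => f k x - F x) 2 μ) atTop (𝓝 0))
    (hgG : Tendsto (fun k => eLpNorm (fun x => g k x - G x) 2 μ) atTop (𝓝 0)) :
    Tendsto (fun k => ∫ x, f k x * g k x ∂μ) atTop (𝓝 (∫ x, F x * G x ∂μ)) := by
  simpa only [inner_toLp] using
    ((Lp.tendsto_Lp_iff_tendsto_eLpNorm'' f hf F hF).2 hfF).inner (𝕜 := ℝ)
      ((Lp.tendsto_Lp_iff_tendsto_eLpNorm'' g hg G hG).2 hgG)

end SquareIntegrable

section IsSimplex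

variable {m : ℕ} {K : Set (Space m)} {F G : Space m → ℝ}

theorem continuous_fderiv_apply (hF : ContDiff ℝ 1 F) (a : Space m) :
    Continuous fun x => fderiv ℝ F x a :=
  (hF.continuous_fderiv one_ne_zero).clm_apply continuous_const

theorem integrable_vol_of_continuous (hK : IsCompact K) (hF : Continuous F) :
    Integrable F (vol K) :=
  hF.continuousOn.integrableOn_compact hK

theorem memLp_vol_of_continuous (hK : IsCompact K) (hF : Continuous F) : MemLp F 2 (vol K) :=
  (memLp_two_iff_integrable_sq hF.aestronglyMeasurable).2
    (integrable_vol_of_continuous hK (hF.pow 2))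

theorem inner_outerNormal_sub_nonpos (x : Space m) {y : Space m} (hy : y ∈ K) :
    inner ℝ (outerNormal K x) (y - x) ≤ 0 := by
  rw [outerNormal]
  split_ifs with h
  · exact h.choose_spec.1.2 y hy
  · simp

theorem le_inner_outerNormal_sub {x x₀ : Space m} {ρ : ℝ} (hρ : 0 ≤ ρ)
    (hball : Metric.closedBall x₀ ρ ⊆ K) (hx : ‖outerNormal K x‖ = 1) :
    ρ ≤ inner ℝ (outerNormal K x) (x - x₀) := by
  have hmem : x₀ + ρ • outerNormal K x ∈ K := hball <| by
    rw [Metric.mem_closedBall, dist_eq_norm, add_sub_cancel_left, norm_smul, hx, mul_one,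
      Real.norm_of_nonneg hρ]
  have hle := inner_outerNormal_sub_nonpos x hmem
  rw [show x₀ + ρ • outerNormal K x - x = ρ • outerNormal K x - (x - x₀) by abel,
    inner_sub_right, real_inner_smul_right, real_inner_self_eq_norm_sq, hx] at hle
  linarith

/-- `K` is a nondegenerate closed simplex: the convex hull of `m + 1` affinely independent points
of `ℝ^m`. -/
def IsSimplex (K : Set (Space m)) : Prop :=
  ∃ b : AffineBasis (Fin (m + 1)) ℝ (Space m), K = convexHull ℝ (range b)

namespace IsSimplex

theorem isCompact (hK : IsSimplex K) : IsCompact K := by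
  obtain ⟨b, rfl⟩ := hK
  exact isCompact_convexHull_range b

theorem convex (hK : IsSimplex K) : Convex ℝ K := by
  obtain ⟨b, rfl⟩ := hK
  exact convex_convexHull ℝ _

theorem exists_closedBall_subset (hK : IsSimplex K) :
    ∃ x₀ ρ, 0 < ρ ∧ Metric.closedBall x₀ ρ ⊆ K := by
  obtain ⟨b, rfl⟩ := hK
  obtain ⟨ρ, hρ, hball⟩ := Metric.nhds_basis_closedBall.mem_iff.1
    (mem_interior_iff_mem_nhds.1 b.centroid_mem_interior_convexHull)
  exact ⟨_, ρ, hρ, hball⟩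

theorem integrable_surf (hK : IsSimplex K) (hF : Continuous F) :
    Integrable F (surf (frontier K)) := by
  obtain ⟨b, rfl⟩ := hK
  exact integrable_surf_frontier_of_continuous b hF

theorem memLp_surf (hK : IsSimplex K) (hF : Continuous F) : MemLp F 2 (surf (frontier K)) :=
  (memLp_two_iff_integrable_sq hF.aestronglyMeasurable).2 (hK.integrable_surf (hF.pow 2))

theorem aestronglyMeasurable_outerNormal (hK : IsSimplex K) :
    AEStronglyMeasurable (outerNormal K) (surf (frontier K)) := by
  obtain ⟨b, rfl⟩ := hK
  exact aestronglyMeasurable_outerNormal_convexHull b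

theorem norm_outerNormal_ae (hK : IsSimplex K) :
    ∀ᵐ x ∂surf (frontier K), ‖outerNormal K x‖ = 1 := by
  obtain ⟨b, rfl⟩ := hK
  rw [surf_frontier_convexHull b, Measure.ae_sum_iff]
  intro i
  filter_upwards [outerNormal_ae_facet b i, ae_restrict_mem (isClosed_facet b i).measurableSet]
    with x hx hxi
  rw [hx, norm_neg, norm_facetNormal b hxi.2]

theorem setIntegral_fderiv (hK : IsSimplex K) (hF : ContDiff ℝ 1 F) (a : Space m) :
    ∫ x in K, fderiv ℝ F x a = ∫ x, F x * inner ℝ (outerNormal K x) a ∂surf (frontier K) := by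
  obtain ⟨b, rfl⟩ := hK
  exact setIntegral_fderiv_convexHull b hF a

theorem integrable_mul_inner_outerNormal (hK : IsSimplex K)
    (hF : Integrable F (surf (frontier K))) (a : Space m) :
    Integrable (fun x => F x * inner ℝ (outerNormal K x) a) (surf (frontier K)) := by
  obtain ⟨b, rfl⟩ := hK
  exact integrable_mul_inner_outerNormal_convexHull b hF a

theorem integrable_inner_outerNormal (hK : IsSimplex K) {W : Space m → Space m}
    (hW : Continuous W) :
    Integrable (fun x => inner ℝ (outerNormal K x) (W x)) (surf (frontier K)) := by
  refine (hK.integrable_surf hW.norm).mono'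
    (hK.aestronglyMeasurable_outerNormal.inner hW.aestronglyMeasurable)
    (Eventually.of_forall fun x => (norm_inner_le_norm _ _).trans ?_)
  exact mul_le_of_le_one_left (norm_nonneg _) (norm_outerNormal_le _ _)

theorem setIntegral_divergence (hK : IsSimplex K) {W : Space m → Space m} (hW : ContDiff ℝ 1 W) :
    ∫ x in K, ∑ μ, fderiv ℝ W x (EuclideanSpace.single μ 1) μ =
      ∫ x, inner ℝ (outerNormal K x) (W x) ∂surf (frontier K) := by
  have hWμ (μ : Fin m) : ContDiff ℝ 1 fun x => W x μ := contDiff_euclidean.1 hW μ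
  have hfderiv (μ : Fin m) (x a : Space m) :
      fderiv ℝ W x a μ = fderiv ℝ (fun x => W x μ) x a := by
    have hcomp := ((EuclideanSpace.proj μ : Space m →L[ℝ] ℝ).hasFDerivAt.comp x
      (hW.differentiable one_ne_zero x).hasFDerivAt).fderiv
    exact (DFunLike.congr_fun hcomp a).symm
  have hinner (x : Space m) : inner ℝ (outerNormal K x) (W x) =
      ∑ μ, W x μ * inner ℝ (outerNormal K x) (EuclideanSpace.single μ 1) := by
    rw [PiLp.inner_apply]
    exact Finset.sum_congr rfl fun μ _ => by simp [EuclideanSpace.inner_single_right]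
  simp_rw [hfderiv, hinner]
  rw [integral_finsetSum _ fun μ _ =>
      integrable_vol_of_continuous hK.isCompact (continuous_fderiv_apply (hWμ μ) _),
    integral_finsetSum _ fun μ _ =>
      hK.integrable_mul_inner_outerNormal (hK.integrable_surf (hWμ μ).continuous) _]
  exact Finset.sum_congr rfl fun μ _ => hK.setIntegral_fderiv (hWμ μ) _

theorem setIntegral_mul_fderiv_add (hK : IsSimplex K) (hF : ContDiff ℝ 1 F) (hG : ContDiff ℝ 1 G)
    (a : Space m) :
    (∫ x in K, F x * fderiv ℝ G x a) + ∫ x in K, fderiv ℝ F x a * G x =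
      ∫ x, F x * (G x * inner ℝ (outerNormal K x) a) ∂surf (frontier K) := by
  rw [← integral_add (f := fun x => F x * fderiv ℝ G x a) (g := fun x => fderiv ℝ F x a * G x)
    (integrable_vol_of_continuous hK.isCompact (hF.continuous.mul (continuous_fderiv_apply hG a)))
    (integrable_vol_of_continuous hK.isCompact ((continuous_fderiv_apply hF a).mul hG.continuous))]
  simp_rw [← mul_assoc]
  rw [← hK.setIntegral_fderiv (hF.mul hG) a]
  refine integral_congr_ae (Eventually.of_forall fun x => ?_)
  simp only [fderiv_fun_mul (hF.differentiable one_ne_zero x) (hG.differentiable one_ne_zero x),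
    add_apply, smul_apply, smul_eq_mul, mul_comm (G x)]

end IsSimplex

theorem fderiv_sq_smul_sub_apply (hF : ContDiff ℝ 1 F) (x₀ x : Space m) (μ : Fin m) :
    fderiv ℝ (fun x => F x ^ 2 • (x - x₀)) x (EuclideanSpace.single μ 1) μ =
      F x ^ 2 + 2 * F x * fderiv ℝ F x (EuclideanSpace.single μ 1) * (x - x₀) μ := by
  have hFx := (hF.differentiable one_ne_zero x).hasFDerivAt
  have hsub : HasFDerivAt (fun x => x - x₀) (.id ℝ (Space m)) x := (hasFDerivAt_id x).sub_const x₀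
  rw [((hFx.pow 2).fun_smul hsub).fderiv]
  simp

theorem sq_add_mul_sub_le {R : ℝ} {x x₀ : Space m}
    (hx : x ∈ Metric.closedBall x₀ R) (μ : Fin m) (c d : ℝ) :
    c ^ 2 + 2 * c * d * (x - x₀) μ ≤ (R + 1) * (c ^ 2 + d ^ 2) := by
  have habs : |(x - x₀) μ| ≤ R :=
    (PiLp.norm_apply_le (x - x₀) μ).trans (by rwa [← dist_eq_norm])
  have hcd : |2 * c * d| ≤ c ^ 2 + d ^ 2 := by
    rw [abs_le]
    constructor <;> nlinarith [sq_nonneg (c + d), sq_nonneg (c - d)]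
  have hmul : 2 * c * d * (x - x₀) μ ≤ (c ^ 2 + d ^ 2) * R := by
    refine (le_abs_self _).trans ?_
    rw [abs_mul]
    exact mul_le_mul hcd habs (abs_nonneg _) (by positivity)
  nlinarith [sq_nonneg d]

theorem IsSimplex.exists_trace_inequality (hK : IsSimplex K) :
    ∃ C : ℝ, ∀ F : Space m → ℝ, ContDiff ℝ 1 F →
      ∫ x, F x ^ 2 ∂surf (frontier K) ≤ C * ∑ μ : Fin m, ((∫ x in K, F x ^ 2) +
        ∫ x in K, fderiv ℝ F x (EuclideanSpace.single μ 1) ^ 2) := by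
  obtain ⟨x₀, ρ, hρ, hball⟩ := hK.exists_closedBall_subset
  obtain ⟨R, hKR⟩ := hK.isCompact.isBounded.subset_closedBall x₀
  refine ⟨ρ⁻¹ * (R + 1), fun F hF => ?_⟩
  have hFsq : Continuous fun x => F x ^ 2 := hF.continuous.pow 2
  have hdsq (μ : Fin m) : Continuous fun x => fderiv ℝ F x (EuclideanSpace.single μ 1) ^ 2 :=
    (continuous_fderiv_apply hF _).pow 2
  have hW : ContDiff ℝ 1 fun x => F x ^ 2 • (x - x₀) := by fun_prop
  have hcompact {f : Space m → ℝ} (hf : Continuous f) :=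
    integrable_vol_of_continuous hK.isCompact hf
  rw [mul_assoc, le_inv_mul_iff₀ hρ]
  calc ρ * ∫ x, F x ^ 2 ∂surf (frontier K)
      = ∫ x, ρ * F x ^ 2 ∂surf (frontier K) := (integral_const_mul _ _).symm
    _ ≤ ∫ x, inner ℝ (outerNormal K x) (F x ^ 2 • (x - x₀)) ∂surf (frontier K) := by
        refine integral_mono_ae ((hK.integrable_surf hFsq).const_mul ρ)
          (hK.integrable_inner_outerNormal hW.continuous) ?_
        filter_upwards [hK.norm_outerNormal_ae] with x hx
        rw [real_inner_smul_right, mul_comm ρ]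
        exact mul_le_mul_of_nonneg_left (le_inner_outerNormal_sub hρ.le hball hx) (sq_nonneg _)
    _ = ∫ x in K, ∑ μ, (F x ^ 2 +
          2 * F x * fderiv ℝ F x (EuclideanSpace.single μ 1) * (x - x₀) μ) := by
        simp_rw [← hK.setIntegral_divergence hW, fderiv_sq_smul_sub_apply hF x₀]
    _ ≤ ∫ x in K, ∑ μ, (R + 1) * (F x ^ 2 + fderiv ℝ F x (EuclideanSpace.single μ 1) ^ 2) := by
        refine setIntegral_mono_on (hcompact ?_) (hcompact ?_) hK.isCompact.measurableSet
          fun x hx => Finset.sum_le_sum fun μ _ => sq_add_mul_sub_le (hKR hx) μ _ _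
        · have := continuous_fderiv_apply hF
          fun_prop
        · fun_prop
    _ = (R + 1) * ∑ μ, ((∫ x in K, F x ^ 2) +
          ∫ x in K, fderiv ℝ F x (EuclideanSpace.single μ 1) ^ 2) := by
        rw [integral_finsetSum _ fun μ _ => hcompact (by fun_prop), Finset.mul_sum]
        refine Finset.sum_congr rfl fun μ _ => ?_
        rw [integral_const_mul, integral_add (hcompact hFsq) (hcompact (hdsq μ))]

end IsSimplex

section TraceOfSmoothApprox

variable {m : ℕ} {K : Set (Space m)} {f : Lp ℝ 2 (vol K)} {φ : ℕ → Space m → ℝ}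

/-- The smooth functions `φ k` converge to `f` in `H¹(K)`: the approximation that enters the
definition of the trace. -/
structure IsSmoothApprox (K : Set (Space m)) (f : Lp ℝ 2 (vol K)) (φ : ℕ → Space m → ℝ) :
    Prop where
  contDiff : ∀ k, ContDiff ℝ ∞ (φ k)
  tendsto : Tendsto (fun k => eLpNorm (fun x => φ k x - f x) 2 (vol K)) atTop (𝓝 0)
  tendsto_fderiv : ∀ μ : Fin m, Tendsto (fun k => eLpNorm (fun x =>
    fderiv ℝ (φ k) x (EuclideanSpace.single μ 1) - weakPartial K μ f x) 2 (vol K)) atTop (𝓝 0)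

namespace IsSmoothApprox

theorem contDiff_one (h : IsSmoothApprox K f φ) (k : ℕ) : ContDiff ℝ 1 (φ k) :=
  (h.contDiff k).of_le (by simp)

theorem memLp (h : IsSmoothApprox K f φ) (hK : IsCompact K) (k : ℕ) : MemLp (φ k) 2 (vol K) :=
  memLp_vol_of_continuous hK (h.contDiff k).continuous

theorem memLp_fderiv (h : IsSmoothApprox K f φ) (hK : IsCompact K) (k : ℕ) (a : Space m) :
    MemLp (fun x => fderiv ℝ (φ k) x a) 2 (vol K) :=
  memLp_vol_of_continuous hK (continuous_fderiv_apply (h.contDiff_one k) a)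

theorem memLp_surf (h : IsSmoothApprox K f φ) (hK : IsSimplex K) (k : ℕ) :
    MemLp (φ k) 2 (surf (frontier K)) :=
  hK.memLp_surf (h.contDiff k).continuous

theorem cauchySeq_toLp (h : IsSmoothApprox K f φ) (hK : IsCompact K) :
    CauchySeq fun k => (h.memLp hK k).toLp (φ k) :=
  ((Lp.tendsto_Lp_iff_tendsto_eLpNorm'' φ (h.memLp hK) f (Lp.memLp f)).2 h.tendsto).cauchySeq

theorem cauchySeq_toLp_fderiv (h : IsSmoothApprox K f φ) (hK : IsCompact K) (μ : Fin m) :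
    CauchySeq fun k => (h.memLp_fderiv hK k (EuclideanSpace.single μ 1)).toLp _ :=
  ((Lp.tendsto_Lp_iff_tendsto_eLpNorm'' _ (fun k => h.memLp_fderiv hK k _) _
    (Lp.memLp (weakPartial K μ f))).2 (h.tendsto_fderiv μ)).cauchySeq

theorem cauchySeq_toLp_surf (h : IsSmoothApprox K f φ) (hK : IsSimplex K) :
    CauchySeq fun k => (h.memLp_surf hK k).toLp (φ k) := by
  obtain ⟨C, htrace⟩ := hK.exists_trace_inequality
  have hdist := cauchySeq_iff_tendsto_dist_atTop_0.1 (h.cauchySeq_toLp hK.isCompact)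
  have hdist_fderiv (μ : Fin m) :=
    cauchySeq_iff_tendsto_dist_atTop_0.1 (h.cauchySeq_toLp_fderiv hK.isCompact μ)
  have hbound := (tendsto_finsetSum Finset.univ fun μ _ =>
    (hdist.pow 2).add ((hdist_fderiv μ).pow 2)).const_mul C
  simp only [ne_eq, OfNat.ofNat_ne_zero, not_false_eq_true, zero_pow, add_zero,
    Finset.sum_const_zero, mul_zero, dist_toLp_sq] at hbound
  refine cauchySeq_iff_tendsto_dist_atTop_0.2 ?_
  suffices hsq : Tendsto (fun kl : ℕ × ℕ =>
      dist ((h.memLp_surf hK kl.1).toLp (φ kl.1)) ((h.memLp_surf hK kl.2).toLp (φ kl.2)) ^ 2)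
      atTop (𝓝 0) by
    simpa only [Real.sqrt_sq dist_nonneg, Real.sqrt_zero] using hsq.sqrt
  refine squeeze_zero (fun _ => sq_nonneg _) (fun kl => ?_) hbound
  have hfderiv (x a : Space m) : fderiv ℝ (fun x => φ kl.1 x - φ kl.2 x) x a =
      fderiv ℝ (φ kl.1) x a - fderiv ℝ (φ kl.2) x a := by
    rw [fderiv_fun_sub ((h.contDiff_one _).differentiable one_ne_zero x)
      ((h.contDiff_one _).differentiable one_ne_zero x), sub_apply]
  simpa only [dist_toLp_sq, hfderiv] using
    htrace _ ((h.contDiff_one kl.1).sub (h.contDiff_one kl.2))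

theorem exists_isTrace (h : IsSmoothApprox K f φ) (hK : IsSimplex K) : ∃ g, IsTrace K f g := by
  obtain ⟨g, hg⟩ := cauchySeq_tendsto_of_complete (h.cauchySeq_toLp_surf hK)
  rw [← Lp.toLp_coeFn g (Lp.memLp g)] at hg
  exact ⟨g, φ, h.contDiff, h.tendsto, h.tendsto_fderiv,
    (Lp.tendsto_Lp_iff_tendsto_eLpNorm'' φ (h.memLp_surf hK) g (Lp.memLp g)).1 hg⟩

end IsSmoothApprox

theorem IsTrace.exists_isSmoothApprox {g : Lp ℝ 2 (surf (frontier K))} (h : IsTrace K f g) :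
    ∃ φ, IsSmoothApprox K f φ ∧
      Tendsto (fun k => eLpNorm (fun x => φ k x - g x) 2 (surf (frontier K))) atTop (𝓝 0) :=
  let ⟨φ, hφ, hf, hf', hg⟩ := h
  ⟨φ, ⟨hφ, hf, hf'⟩, hg⟩

theorem norm_outerNormal_apply_le (K : Set (Space m)) (x : Space m) (μ : Fin m) :
    ‖outerNormal K x μ‖ ≤ 1 :=
  (PiLp.norm_apply_le _ μ).trans (norm_outerNormal_le K x)

theorem IsSimplex.memLp_mul_outerNormal (hK : IsSimplex K) {F : Space m → ℝ}
    (hF : MemLp F 2 (surf (frontier K))) (μ : Fin m) :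
    MemLp (fun x => F x * outerNormal K x μ) 2 (surf (frontier K)) := by
  have hN : AEStronglyMeasurable (fun x => outerNormal K x μ) (surf (frontier K)) :=
    (EuclideanSpace.proj μ : Space m →L[ℝ] ℝ).continuous.comp_aestronglyMeasurable
      hK.aestronglyMeasurable_outerNormal
  refine hF.of_le (hF.1.mul hN) (Eventually.of_forall fun x => ?_)
  rw [norm_mul]
  exact mul_le_of_le_one_right (norm_nonneg _) (norm_outerNormal_apply_le K x μ)

theorem tendsto_eLpNorm_mul_outerNormal {g : Space m → ℝ}
    (hφ : Tendsto (fun k => eLpNorm (fun x => φ k x - g x) 2 (surf (frontier K))) atTop (𝓝 0))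
    (μ : Fin m) :
    Tendsto (fun k => eLpNorm (fun x => φ k x * outerNormal K x μ - g x * outerNormal K x μ) 2
      (surf (frontier K))) atTop (𝓝 0) := by
  refine tendsto_of_tendsto_of_tendsto_of_le_of_le tendsto_const_nhds hφ (fun _ => zero_le)
    fun k => eLpNorm_mono fun x => ?_
  rw [← sub_mul, norm_mul]
  exact mul_le_of_le_one_right (norm_nonneg _) (norm_outerNormal_apply_le K x μ)

theorem IsTrace.setIntegral_mul_weakPartial_add (hK : IsSimplex K) {g : Lp ℝ 2 (vol K)}
    {f' g' : Lp ℝ 2 (surf (frontier K))} (hf : IsTrace K f f') (hg : IsTrace K g g') (μ : Fin m) :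
    (∫ x in K, f x * weakPartial K μ g x) + ∫ x in K, weakPartial K μ f x * g x =
      ∫ x, f' x * (g' x * outerNormal K x μ) ∂surf (frontier K) := by
  obtain ⟨φ, hφ, hφf'⟩ := hf.exists_isSmoothApprox
  obtain ⟨ψ, hψ, hψg'⟩ := hg.exists_isSmoothApprox
  have hKc := hK.isCompact
  have hfg := tendsto_integral_mul (hφ.memLp hKc) (fun k => hψ.memLp_fderiv hKc k _) (Lp.memLp f)
    (Lp.memLp _) hφ.tendsto (hψ.tendsto_fderiv μ)
  have hgf := tendsto_integral_mul (fun k => hφ.memLp_fderiv hKc k _) (hψ.memLp hKc) (Lp.memLp _)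
    (Lp.memLp g) (hφ.tendsto_fderiv μ) hψ.tendsto
  have hbdry := tendsto_integral_mul (hφ.memLp_surf hK)
    (fun k => hK.memLp_mul_outerNormal (hψ.memLp_surf hK k) μ) (Lp.memLp f')
    (hK.memLp_mul_outerNormal (Lp.memLp g') μ) hφf' (tendsto_eLpNorm_mul_outerNormal hψg' μ)
  refine tendsto_nhds_unique ((hfg.add hgf).congr fun k => ?_) hbdry
  simpa [EuclideanSpace.inner_single_right] using hK.setIntegral_mul_fderiv_add
    (hφ.contDiff_one k) (hψ.contDiff_one k) (EuclideanSpace.single μ 1)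

end TraceOfSmoothApprox

section UniformConvergence

variable {α : Type*} {_ : MeasurableSpace α} {μ : Measure α} {ι : Type*} {u : Filter ι}

theorem tendsto_eLpNorm_restrict_of_tendstoUniformlyOn {p : ENNReal} {s : Set α} {F : α → ℝ}
    {f : ι → α → ℝ} (hs : MeasurableSet s) (hμs : μ s ≠ ⊤) (h : TendstoUniformlyOn f F u s) :
    Tendsto (fun k => eLpNorm (fun x => f k x - F x) p (μ.restrict s)) u (𝓝 0) := by
  set A := μ s ^ p.toReal⁻¹
  have hA : A ≠ ⊤ := ENNReal.rpow_ne_top_of_nonneg (by positivity) hμs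
  have hlim : Tendsto (fun c : ℝ => A * ENNReal.ofReal c) (𝓝[>] 0) (𝓝 0) := by
    simpa using (ENNReal.Tendsto.const_mul (ENNReal.tendsto_ofReal tendsto_id)
      (Or.inr hA)).mono_left (nhdsWithin_le_nhds (a := (0 : ℝ)) (s := Ioi 0))
  refine ENNReal.tendsto_nhds_zero.2 fun e he => ?_
  obtain ⟨c, hc, hc0⟩ := ((hlim.eventually (ge_mem_nhds he)).and self_mem_nhdsWithin).exists
  filter_upwards [Metric.tendstoUniformlyOn_iff.1 h c hc0] with k hk
  refine (eLpNorm_le_of_ae_bound (C := c) ?_).trans (by rwa [Measure.restrict_apply_univ])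
  filter_upwards [ae_restrict_mem hs] with x hx
  rw [← dist_eq_norm, dist_comm]
  exact (hk x hx).le

end UniformConvergence

noncomputable section Mollification

variable {E : Type*} [NormedAddCommGroup E] [NormedSpace ℝ E] [MeasurableSpace E]
  {μ : Measure E} {η : E → ℝ} {δ l : ℝ} {x₀ : E} {F G : E → ℝ}

/-- `η` is a smoothing kernel of radius `δ`: a smooth probability density with respect to `μ` that
vanishes outside the ball of radius `δ` about the origin. -/
structure IsMollifier (μ : Measure E) (η : E → ℝ) (δ : ℝ) : Prop where
  contDiff : ContDiff ℝ ∞ η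
  nonneg : ∀ z, 0 ≤ η z
  integral_eq_one : ∫ z, η z ∂μ = 1
  support_subset : Function.support η ⊆ Metric.ball 0 δ

/-- The dilation `x ↦ l (x - x₀) + x₀` followed by convolution with the kernel `η`. For `l < 1`, a
small kernel and `x` in a convex body with `x₀` in its interior, the value at `x` depends on `F` in
the interior of that body only. -/
def mollify (μ : Measure E) (η : E → ℝ) (l : ℝ) (x₀ : E) (F : E → ℝ) (x : E) : ℝ :=
  convolution η F (ContinuousLinearMap.lsmul ℝ ℝ) μ (l • (x - x₀) + x₀)

namespace IsMollifier

theorem continuous (hη : IsMollifier μ η δ) : Continuous η :=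
  hη.contDiff.continuous

theorem hasCompactSupport [ProperSpace E] (hη : IsMollifier μ η δ) : HasCompactSupport η :=
  .of_support_subset_isCompact (isCompact_closedBall 0 δ)
    (hη.support_subset.trans Metric.ball_subset_closedBall)

theorem withDensity_univ (hη : IsMollifier μ η δ) :
    (μ.withDensity fun z => ‖η z‖ₑ) univ = 1 := by
  have hint : Integrable η μ := integrable_of_integral_eq_one hη.integral_eq_one
  rw [withDensity_apply _ MeasurableSet.univ, Measure.restrict_univ, ← ENNReal.ofReal_one,
    ← hη.integral_eq_one, ofReal_integral_eq_lintegral_ofReal hint (.of_forall hη.nonneg)]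
  exact lintegral_congr fun z => Real.enorm_of_nonneg (hη.nonneg z)

end IsMollifier

theorem enorm_mollify_le [BorelSpace E] {p : ENNReal} (hp : 1 ≤ p) (hη : IsMollifier μ η δ)
    (hF : Measurable F) (x : E) :
    ‖mollify μ η l x₀ F x‖ₑ ≤
      eLpNorm (fun z => F (l • (x - x₀) + x₀ - z)) p (μ.withDensity fun z => ‖η z‖ₑ) := by
  have : IsProbabilityMeasure (μ.withDensity fun z => ‖η z‖ₑ) := ⟨hη.withDensity_univ⟩
  have hm : Measurable fun z => F (l • (x - x₀) + x₀ - z) :=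
    hF.comp (measurable_id.const_sub _)
  refine le_trans ?_ (eLpNorm_le_eLpNorm_of_exponent_le hp hm.aestronglyMeasurable)
  rw [eLpNorm_one_eq_lintegral_enorm,
    lintegral_withDensity_eq_lintegral_mul _ hη.continuous.measurable.enorm hm.enorm]
  refine (enorm_integral_le_lintegral_enorm _).trans_eq (lintegral_congr fun z => ?_)
  exact enorm_mul _ _

variable [FiniteDimensional ℝ E] [BorelSpace E] [μ.IsAddHaarMeasure]

theorem exists_isMollifier (μ : Measure E) [μ.IsAddHaarMeasure] (hδ : 0 < δ) :
    ∃ η, IsMollifier μ η δ :=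
  let η : ContDiffBump (0 : E) := ⟨δ / 2, δ, half_pos hδ, half_lt_self hδ⟩
  ⟨η.normed μ, η.contDiff_normed, η.nonneg_normed, η.integral_normed, η.support_normed_eq.subset⟩

theorem lintegral_comp_dilation (hl : 0 < l) (x₀ z : E) {g : E → ENNReal} (hg : Measurable g) :
    ∫⁻ x, g (l • (x - x₀) + x₀ - z) ∂μ =
      ENNReal.ofReal (l ^ Module.finrank ℝ E)⁻¹ * ∫⁻ x, g x ∂μ := by
  calc ∫⁻ x, g (l • (x - x₀) + x₀ - z) ∂μ
      = ∫⁻ x, g (l • x + x₀ - z) ∂μ :=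
        lintegral_sub_right_eq_self (fun x => g (l • x + x₀ - z)) x₀
    _ = ∫⁻ x, g (x + x₀ - z) ∂μ.map (l • ·) := by rw [lintegral_map (by fun_prop) (by fun_prop)]
    _ = ENNReal.ofReal (l ^ Module.finrank ℝ E)⁻¹ * ∫⁻ x, g (x + (x₀ - z)) ∂μ := by
        rw [Measure.map_addHaar_smul μ hl.ne', lintegral_smul_measure, smul_eq_mul,
          abs_of_pos (by positivity)]
        simp_rw [add_sub_assoc]
    _ = ENNReal.ofReal (l ^ Module.finrank ℝ E)⁻¹ * ∫⁻ x, g x ∂μ := by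
        rw [lintegral_add_right_eq_self g]

theorem lintegral_mollify_rpow_le {p : ENNReal} (hp : 1 ≤ p) (hp' : p ≠ ⊤)
    (hη : IsMollifier μ η δ) (hl : 0 < l) (x₀ : E) (hF : Measurable F) :
    ∫⁻ x, ‖mollify μ η l x₀ F x‖ₑ ^ p.toReal ∂μ ≤
      ENNReal.ofReal (l ^ Module.finrank ℝ E)⁻¹ * ∫⁻ x, ‖F x‖ₑ ^ p.toReal ∂μ := by
  set ν := μ.withDensity fun z => ‖η z‖ₑ
  have hν : ν univ = 1 := hη.withDensity_univ
  have : IsProbabilityMeasure ν := ⟨hν⟩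
  have hp0 : p ≠ 0 := (one_pos.trans_le hp).ne'
  have hpow : Measurable fun x => ‖F x‖ₑ ^ p.toReal := hF.enorm.pow_const _
  have hpoint (x : E) : ‖mollify μ η l x₀ F x‖ₑ ^ p.toReal ≤
      ∫⁻ z, ‖F (l • (x - x₀) + x₀ - z)‖ₑ ^ p.toReal ∂ν := by
    rw [lintegral_rpow_enorm_eq_rpow_eLpNorm' (ENNReal.toReal_pos hp0 hp'),
      ← eLpNorm_eq_eLpNorm' hp0 hp']
    exact ENNReal.rpow_le_rpow (enorm_mollify_le hp hη hF x) ENNReal.toReal_nonneg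
  calc ∫⁻ x, ‖mollify μ η l x₀ F x‖ₑ ^ p.toReal ∂μ
      ≤ ∫⁻ x, ∫⁻ z, ‖F (l • (x - x₀) + x₀ - z)‖ₑ ^ p.toReal ∂ν ∂μ := lintegral_mono hpoint
    _ = ∫⁻ z, ∫⁻ x, ‖F (l • (x - x₀) + x₀ - z)‖ₑ ^ p.toReal ∂μ ∂ν :=
        lintegral_lintegral_swap (hpow.comp (by fun_prop :
          Measurable fun q : E × E => l • (q.1 - x₀) + x₀ - q.2)).aemeasurable
    _ = ENNReal.ofReal (l ^ Module.finrank ℝ E)⁻¹ * ∫⁻ x, ‖F x‖ₑ ^ p.toReal ∂μ := by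
        simp_rw [lintegral_comp_dilation hl x₀ _ hpow]
        rw [lintegral_const, hν, mul_one]

theorem eLpNorm_mollify_le {p : ENNReal} (hp : 1 ≤ p) (hp' : p ≠ ⊤) (hη : IsMollifier μ η δ)
    (hl : 1 / 2 ≤ l) (x₀ : E) (hF : Measurable F) :
    eLpNorm (mollify μ η l x₀ F) p μ ≤ 2 ^ Module.finrank ℝ E * eLpNorm F p μ := by
  have hl0 : 0 < l := one_half_pos.trans_le hl
  have hp0 : p ≠ 0 := (one_pos.trans_le hp).ne'
  have hp1 : 1 / p.toReal ≤ 1 :=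
    div_le_one_of_le₀ (by simpa using ENNReal.toReal_mono hp' hp) ENNReal.toReal_nonneg
  have hscale : ENNReal.ofReal (l ^ Module.finrank ℝ E)⁻¹ ≤ 2 ^ Module.finrank ℝ E := by
    have hinv : ENNReal.ofReal l⁻¹ ≤ 2 := by
      refine ENNReal.ofReal_le_of_le_toReal ?_
      simpa using inv_anti₀ one_half_pos hl
    rw [← inv_pow, ENNReal.ofReal_pow (by positivity)]
    gcongr
  rw [eLpNorm_eq_lintegral_rpow_enorm_toReal hp0 hp',
    eLpNorm_eq_lintegral_rpow_enorm_toReal hp0 hp']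
  calc (∫⁻ x, ‖mollify μ η l x₀ F x‖ₑ ^ p.toReal ∂μ) ^ (1 / p.toReal)
      ≤ (2 ^ Module.finrank ℝ E * ∫⁻ x, ‖F x‖ₑ ^ p.toReal ∂μ) ^ (1 / p.toReal) := by
        grw [lintegral_mollify_rpow_le hp hp' hη hl0 x₀ hF, hscale]
    _ = (2 ^ Module.finrank ℝ E) ^ (1 / p.toReal) *
          (∫⁻ x, ‖F x‖ₑ ^ p.toReal ∂μ) ^ (1 / p.toReal) :=
        ENNReal.mul_rpow_of_nonneg _ _ (by positivity)
    _ ≤ 2 ^ Module.finrank ℝ E * (∫⁻ x, ‖F x‖ₑ ^ p.toReal ∂μ) ^ (1 / p.toReal) := by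
        gcongr
        simpa using ENNReal.rpow_le_rpow_of_exponent_le
          (one_le_pow₀ (n := Module.finrank ℝ E) one_le_two) hp1

theorem mollify_sub (hη : IsMollifier μ η δ) (hF : LocallyIntegrable F μ)
    (hG : LocallyIntegrable G μ) (x : E) :
    mollify μ η l x₀ (F - G) x = mollify μ η l x₀ F x - mollify μ η l x₀ G x := by
  have hexists {F : E → ℝ} (hF : LocallyIntegrable F μ) (y : E) :
      Integrable (fun z => η z • F (y - z)) μ :=
    hη.hasCompactSupport.convolutionExists_left (ContinuousLinearMap.lsmul ℝ ℝ) hη.continuous hF y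
  simp only [mollify, convolution_def, ContinuousLinearMap.lsmul_apply, Pi.sub_apply, smul_sub]
  exact integral_sub (hexists hF _) (hexists hG _)

theorem contDiff_mollify (hη : IsMollifier μ η δ) (l : ℝ) (x₀ : E) (hF : LocallyIntegrable F μ) :
    ContDiff ℝ ∞ (mollify μ η l x₀ F) :=
  (hη.hasCompactSupport.contDiff_convolution_left (ContinuousLinearMap.lsmul ℝ ℝ) (n := ⊤)
    hη.contDiff hF).comp (by fun_prop : ContDiff ℝ ∞ fun x : E => l • (x - x₀) + x₀)

theorem fderiv_mollify (hη : IsMollifier μ η δ) (hF : LocallyIntegrable F μ) (x a : E) :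
    fderiv ℝ (mollify μ η l x₀ F) x a =
      l * mollify μ (fun z => fderiv ℝ η z a) l x₀ F x := by
  set y := l • (x - x₀) + x₀ with hy
  set L : ℝ →L[ℝ] ℝ →L[ℝ] ℝ := ContinuousLinearMap.lsmul ℝ ℝ
  have hη1 : ContDiff ℝ 1 η := hη.contDiff.of_le (by simp)
  have hdilation : HasFDerivAt (fun x : E => l • (x - x₀) + x₀) (l • .id ℝ E) x :=
    (((hasFDerivAt_id x).sub_const x₀).const_smul l).add_const x₀
  have hmollify : HasFDerivAt (mollify μ η l x₀ F)
      ((convolution (fderiv ℝ η) F (L.precompL E) μ y).comp (l • .id ℝ E)) x :=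
    (hη.hasCompactSupport.hasFDerivAt_convolution_left L hη1 hF y).comp x hdilation
  have hexists := (hη.hasCompactSupport.fderiv ℝ).convolutionExists_left (L.precompL E)
    (hη1.continuous_fderiv one_ne_zero) hF y
  rw [hmollify.fderiv, ContinuousLinearMap.comp_apply, smul_apply, ContinuousLinearMap.id_apply,
    map_smul, smul_eq_mul, mollify, ← hy, convolution_def, convolution_def,
    ContinuousLinearMap.integral_apply hexists]
  rfl

end Mollification

section Convergence

variable {E : Type*} [NormedAddCommGroup E] [NormedSpace ℝ E] [FiniteDimensional ℝ E]
  [MeasurableSpace E] [BorelSpace E] {μ : Measure E} [μ.IsAddHaarMeasure] {x₀ : E} {K : Set E}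
  {ι : Type*} {u : Filter ι} {η : ι → E → ℝ} {δ l : ι → ℝ} {p : ENNReal} {F : E → ℝ}

theorem tendstoUniformlyOn_mollify {H : E → ℝ}
    (hη : ∀ k, IsMollifier μ (η k) (δ k)) (hδ : Tendsto δ u (𝓝 0)) (hl : Tendsto l u (𝓝 1))
    (hK : Bornology.IsBounded K) (hH : UniformContinuous H) :
    TendstoUniformlyOn (fun k => mollify μ (η k) (l k) x₀ H) H u K := by
  obtain ⟨R, hR⟩ := hK.subset_closedBall x₀
  refine Metric.tendstoUniformlyOn_iff.2 fun e he => ?_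
  obtain ⟨d, hd, hHd⟩ := Metric.uniformContinuous_iff.1 hH (e / 2) (half_pos he)
  have hlim : Tendsto (fun k => δ k + |l k - 1| * R) u (𝓝 0) := by
    simpa using hδ.add (((hl.sub_const 1).abs).mul_const R)
  filter_upwards [hlim.eventually (gt_mem_nhds hd)] with k hk x hx
  rw [dist_comm]
  refine (dist_convolution_le (half_pos he).le (hη k).support_subset (hη k).nonneg
    (hη k).integral_eq_one hH.continuous.aestronglyMeasurable fun w hw => ?_).trans_lt
    (half_lt_self he)
  refine (hHd (lt_of_le_of_lt ?_ hk)).le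
  have hxR : ‖x - x₀‖ ≤ R := by simpa [dist_eq_norm] using hR hx
  calc dist w x ≤ dist w (l k • (x - x₀) + x₀) + dist (l k • (x - x₀) + x₀) x :=
        dist_triangle _ _ _
    _ ≤ δ k + |l k - 1| * R := by
        refine add_le_add hw.le ?_
        rw [dist_eq_norm, show l k • (x - x₀) + x₀ - x = (l k - 1) • (x - x₀) by
          rw [sub_smul, one_smul]; abel, norm_smul, Real.norm_eq_abs]
        exact mul_le_mul_of_nonneg_left hxR (abs_nonneg _)

theorem eLpNorm_mollify_sub_le {η : E → ℝ} {δ l : ℝ} {H : E → ℝ} (hp : 1 ≤ p) (hp' : p ≠ ⊤)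
    (hη : IsMollifier μ η δ) (hl : 1 / 2 ≤ l) (hF : MemLp F p μ) (hFm : Measurable F)
    (hH : Continuous H) :
    eLpNorm (fun x => mollify μ η l x₀ F x - F x) p (μ.restrict K) ≤
      (2 ^ Module.finrank ℝ E + 1) * eLpNorm (F - H) p μ +
        eLpNorm (fun x => mollify μ η l x₀ H x - H x) p (μ.restrict K) := by
  have hFint : LocallyIntegrable F μ := hF.locallyIntegrable hp
  have hHint : LocallyIntegrable H μ := hH.locallyIntegrable
  have hmollify {G : E → ℝ} (hG : LocallyIntegrable G μ) :
      AEStronglyMeasurable (mollify μ η l x₀ G) (μ.restrict K) :=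
    (contDiff_mollify hη l x₀ hG).continuous.aestronglyMeasurable
  have hFH : AEStronglyMeasurable (F - H) (μ.restrict K) :=
    (hFm.sub hH.measurable).aestronglyMeasurable
  have hsplit : (fun x => mollify μ η l x₀ F x - F x) =
      mollify μ η l x₀ (F - H) - (F - H) + (fun x => mollify μ η l x₀ H x - H x) := by
    ext x
    simp only [Pi.add_apply, Pi.sub_apply, mollify_sub hη hFint hHint]
    ring
  have hmollify_FH := hmollify (hFint.sub hHint)
  rw [hsplit]
  refine (eLpNorm_add_le (hmollify_FH.sub hFH)
    ((hmollify hHint).sub hH.aestronglyMeasurable) hp).trans (add_le_add_left ?_ _)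
  calc eLpNorm (mollify μ η l x₀ (F - H) - (F - H)) p (μ.restrict K)
      ≤ eLpNorm (mollify μ η l x₀ (F - H)) p (μ.restrict K) + eLpNorm (F - H) p (μ.restrict K) :=
        eLpNorm_sub_le hmollify_FH hFH hp
    _ ≤ eLpNorm (mollify μ η l x₀ (F - H)) p μ + eLpNorm (F - H) p μ :=
        add_le_add (eLpNorm_mono_measure _ Measure.restrict_le_self)
          (eLpNorm_mono_measure _ Measure.restrict_le_self)
    _ ≤ (2 ^ Module.finrank ℝ E + 1) * eLpNorm (F - H) p μ := by
        rw [add_mul, one_mul]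
        gcongr
        exact eLpNorm_mollify_le hp hp' hη hl x₀ (hFm.sub hH.measurable)

theorem tendsto_eLpNorm_mollify_sub (hp : 1 ≤ p) (hp' : p ≠ ⊤)
    (hη : ∀ k, IsMollifier μ (η k) (δ k)) (hδ : Tendsto δ u (𝓝 0)) (hl : Tendsto l u (𝓝 1))
    (hl2 : ∀ k, 1 / 2 ≤ l k) (x₀ : E) (hK : IsCompact K) (hF : MemLp F p μ)
    (hFm : Measurable F) :
    Tendsto (fun k => eLpNorm (fun x => mollify μ (η k) (l k) x₀ F x - F x) p (μ.restrict K))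
      u (𝓝 0) := by
  refine ENNReal.tendsto_nhds_zero.2 fun e he => ?_
  set C : ENNReal := 2 ^ Module.finrank ℝ E + 1
  have hC : C ≠ 0 := by positivity
  have hC' : C ≠ ⊤ := by finiteness
  have he2 : e / 2 ≠ 0 := (ENNReal.half_pos he.ne').ne'
  obtain ⟨H, hHsupp, hFH, hH, -⟩ :=
    hF.exists_hasCompactSupport_eLpNorm_sub_le hp' (ENNReal.div_ne_zero.2 ⟨he2, hC'⟩)
  have huniform := tendstoUniformlyOn_mollify (x₀ := x₀) hη hδ hl hK.isBounded
    (hHsupp.uniformContinuous_of_continuous hH)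
  have hlim := tendsto_eLpNorm_restrict_of_tendstoUniformlyOn (μ := μ) (p := p)
    hK.measurableSet hK.measure_lt_top.ne huniform
  filter_upwards [ENNReal.tendsto_nhds_zero.1 hlim (e / 2) (pos_iff_ne_zero.2 he2)] with k hk
  calc eLpNorm (fun x => mollify μ (η k) (l k) x₀ F x - F x) p (μ.restrict K)
      ≤ C * eLpNorm (F - H) p μ +
          eLpNorm (fun x => mollify μ (η k) (l k) x₀ H x - H x) p (μ.restrict K) :=
        eLpNorm_mollify_sub_le hp hp' (hη k) (hl2 k) hF hFm hH
    _ ≤ C * (e / 2 / C) + e / 2 := by gcongr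
    _ = e := by rw [ENNReal.mul_div_cancel hC hC', ENNReal.add_halves]

end Convergence

section Density

theorem closedBall_dilation_subset {E : Type*} [NormedAddCommGroup E] [NormedSpace ℝ E]
    {K : Set E} (hK : Convex ℝ K) {x₀ x : E} {ρ l δ : ℝ} (hball : Metric.closedBall x₀ ρ ⊆ K)
    (hx : x ∈ K) (hl0 : 0 ≤ l) (hl1 : l < 1) (hδ : δ < (1 - l) * ρ) :
    Metric.closedBall (l • (x - x₀) + x₀) δ ⊆ interior K := by
  intro w hw
  rw [Metric.mem_closedBall, dist_eq_norm] at hw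
  have hl : 0 < 1 - l := sub_pos.2 hl1
  set c := x₀ + (1 - l)⁻¹ • (w - (l • (x - x₀) + x₀)) with hc
  have hcK : c ∈ interior K := by
    refine interior_mono hball (Metric.ball_subset_interior_closedBall ?_)
    rw [Metric.mem_ball, dist_eq_norm, hc, add_sub_cancel_left, norm_smul, norm_inv,
      Real.norm_of_nonneg hl.le, inv_mul_lt_iff₀ hl]
    exact hw.trans_lt hδ
  have hw_combo : (1 - l) • c + l • x = w := by
    rw [hc, smul_add, smul_smul, mul_inv_cancel₀ hl.ne', one_smul, smul_sub, sub_smul, one_smul]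
    abel
  exact hw_combo ▸ hK.combo_interior_self_subset_interior hl hl0 (sub_add_cancel 1 l)
    (Set.add_mem_add (smul_mem_smul_set hcK) (smul_mem_smul_set hx))

theorem mollify_indicator {E : Type*} [NormedAddCommGroup E] [NormedSpace ℝ E]
    [MeasurableSpace E] [BorelSpace E] {μ : Measure E} [μ.IsAddLeftInvariant] [μ.IsNegInvariant]
    {K : Set E} (hK : MeasurableSet K) (η : E → ℝ) (l : ℝ) (x₀ : E) (f : E → ℝ) (x : E) :
    mollify μ η l x₀ (K.indicator f) x = ∫ w in K, η (l • (x - x₀) + x₀ - w) * f w ∂μ := by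
  rw [mollify, convolution_lsmul_swap, ← integral_indicator hK]
  refine integral_congr_ae (Eventually.of_forall fun w => ?_)
  by_cases hw : w ∈ K <;> simp [hw]

theorem exists_dilation_parameters {ρ : ℝ} (hρ : 0 < ρ) :
    ∃ l δ : ℕ → ℝ, Tendsto l atTop (𝓝 1) ∧ Tendsto δ atTop (𝓝 0) ∧
      ∀ k, 1 / 2 ≤ l k ∧ l k < 1 ∧ 0 < δ k ∧ δ k < (1 - l k) * ρ := by
  have hlim := tendsto_one_div_add_atTop_nhds_zero_nat (𝕜 := ℝ)
  refine ⟨fun k => 1 - 2⁻¹ * (1 / ((k : ℝ) + 1)), fun k => ρ / 4 * (1 / ((k : ℝ) + 1)),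
    by simpa using (hlim.const_mul 2⁻¹).const_sub 1, by simpa using hlim.const_mul (ρ / 4),
    fun k => ?_⟩
  have hpos : 0 < 1 / ((k : ℝ) + 1) := Nat.one_div_pos_of_nat
  have hle : 1 / ((k : ℝ) + 1) ≤ 1 := div_le_one_of_le₀ (by simp) (by positivity)
  exact ⟨by linarith, by linarith, by positivity, by nlinarith [mul_pos hρ hpos]⟩

theorem tendsto_eLpNorm_mul_sub {α ι : Type*} {_ : MeasurableSpace α} {μ : Measure α}
    {u : Filter ι} {p : ENNReal} [Fact (1 ≤ p)] {a : ι → ℝ} {h : ι → α → ℝ} {F : α → ℝ}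
    (hh : ∀ k, MemLp (h k) p μ) (hF : MemLp F p μ) (ha : Tendsto a u (𝓝 1))
    (hlim : Tendsto (fun k => eLpNorm (fun x => h k x - F x) p μ) u (𝓝 0)) :
    Tendsto (fun k => eLpNorm (fun x => a k * h k x - F x) p μ) u (𝓝 0) := by
  have hsmul := ha.smul ((Lp.tendsto_Lp_iff_tendsto_eLpNorm'' h hh F hF).2 hlim)
  rw [one_smul] at hsmul
  exact (Lp.tendsto_Lp_iff_tendsto_eLpNorm'' _ (fun k => (hh k).const_smul (a k)) F hF).1 hsmul

variable {m : ℕ} {K : Set (Space m)} {f g : Lp ℝ 2 (vol K)}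

theorem memLp_indicator (hK : MeasurableSet K) (f : Lp ℝ 2 (vol K)) :
    MemLp (K.indicator f) 2 volume :=
  (memLp_indicator_iff_restrict hK).2 (Lp.memLp f)

theorem hasWeakPartial_weakPartial (hf : MemH1 K f) (μ : Fin m) :
    HasWeakPartial K μ f (weakPartial K μ f) := by
  rw [weakPartial, dif_pos (hf μ)]
  exact (hf μ).choose_spec

theorem HasWeakPartial.fderiv_mollify {μ : Fin m} (hfg : HasWeakPartial K μ f g)
    (hK : IsCompact K) {η : Space m → ℝ} {δ l : ℝ} {x₀ x : Space m}
    (hη : IsMollifier volume η δ)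
    (hball : Metric.closedBall (l • (x - x₀) + x₀) δ ⊆ interior K) :
    fderiv ℝ (mollify volume η l x₀ (K.indicator f)) x (EuclideanSpace.single μ 1) =
      l * mollify volume η l x₀ (K.indicator g) x := by
  rw [HybridDDW.fderiv_mollify hη ((memLp_indicator hK.measurableSet f).locallyIntegrable
      one_le_two), mollify_indicator hK.measurableSet, mollify_indicator hK.measurableSet]
  set y := l • (x - x₀) + x₀
  set e : Space m := EuclideanSpace.single μ 1
  have htsupport : tsupport (fun w => η (y - w)) ⊆ interior K := by
    refine (closure_minimal (fun w hw => ?_) Metric.isClosed_closedBall).trans hball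
    have hyw := hη.support_subset (Function.mem_support.2 hw)
    rw [mem_ball_zero_iff, norm_sub_rev, ← dist_eq_norm] at hyw
    exact hyw.le
  have hcompact : HasCompactSupport fun w => η (y - w) :=
    hK.of_isClosed_subset (isClosed_tsupport _) (htsupport.trans interior_subset)
  have hfderiv (w : Space m) : fderiv ℝ (fun w => η (y - w)) w e = -fderiv ℝ η (y - w) e := by
    have hfderivAt : HasFDerivAt (fun w => η (y - w)) _ w :=
      (hη.contDiff.differentiable (by simp) (y - w)).hasFDerivAt.comp w
        ((hasFDerivAt_id w).const_sub y)
    rw [hfderivAt.fderiv]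
    simp
  have hweak : ∫ w in K, f w * fderiv ℝ (fun w => η (y - w)) w e =
      -∫ w in K, g w * η (y - w) :=
    hfg _ (hη.contDiff.comp (contDiff_const.sub contDiff_id)) hcompact htsupport
  simp only [hfderiv, neg_mul, integral_neg, neg_inj, mul_comm (f _), mul_comm (g _)] at hweak
  rw [hweak]

theorem exists_isSmoothApprox (hK : IsCompact K) (hconv : Convex ℝ K) {x₀ : Space m} {ρ : ℝ}
    (hρ : 0 < ρ) (hball : Metric.closedBall x₀ ρ ⊆ K) (hf : MemH1 K f) :
    ∃ φ, IsSmoothApprox K f φ := by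
  obtain ⟨l, δ, hl, hδ, hlδ⟩ := exists_dilation_parameters hρ
  choose η hη using fun k => exists_isMollifier (volume : Measure (Space m)) (hlδ k).2.2.1
  have hcontDiff (g : Lp ℝ 2 (vol K)) (k : ℕ) :
      ContDiff ℝ ∞ (mollify volume (η k) (l k) x₀ (K.indicator g)) :=
    contDiff_mollify (hη k) _ _
      ((memLp_indicator hK.measurableSet g).locallyIntegrable one_le_two)
  have hlim (g : Lp ℝ 2 (vol K)) : Tendsto (fun k => eLpNorm (fun x =>
      mollify volume (η k) (l k) x₀ (K.indicator g) x - g x) 2 (vol K)) atTop (𝓝 0) := by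
    refine (tendsto_eLpNorm_mollify_sub one_le_two ENNReal.ofNat_ne_top hη hδ hl
      (fun k => (hlδ k).1) x₀ hK (memLp_indicator hK.measurableSet g)
      ((Lp.stronglyMeasurable g).measurable.indicator hK.measurableSet)).congr
      fun k => eLpNorm_congr_ae ?_
    filter_upwards [ae_restrict_mem hK.measurableSet] with x hx
    rw [indicator_of_mem hx]
  refine ⟨_, hcontDiff f, hlim f, fun μ => ?_⟩
  refine (tendsto_eLpNorm_mul_sub (fun k => memLp_vol_of_continuous hK (hcontDiff _ k).continuous)
    (Lp.memLp _) hl (hlim (weakPartial K μ f))).congr fun k => eLpNorm_congr_ae ?_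
  filter_upwards [ae_restrict_mem hK.measurableSet] with x hx
  obtain ⟨hl2, hl1, -, hδl⟩ := hlδ k
  rw [(hasWeakPartial_weakPartial hf μ).fderiv_mollify hK (hη k)
    (closedBall_dilation_subset hconv hball hx (one_half_pos.le.trans hl2) hl1 hδl)]

theorem IsSimplex.isTrace_trace (hK : IsSimplex K) (hf : MemH1 K f) :
    IsTrace K f (trace K f) := by
  obtain ⟨x₀, ρ, hρ, hball⟩ := hK.exists_closedBall_subset
  obtain ⟨φ, hφ⟩ := exists_isSmoothApprox hK.isCompact hK.convex hρ hball hf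
  have htrace := hφ.exists_isTrace hK
  rw [trace, dif_pos htrace]
  exact htrace.choose_spec

end Density

section Pairing

variable {m n : ℕ} {K : Set (Space m)}

/-- The pointwise inner product `L² × L² → L¹`, bundled as a continuous bilinear map so that the
density `du ∧ dp` can be differentiated in `L¹(K)`. -/
noncomputable def pairing (K : Set (Space m)) :
    Lp (Fld n) 2 (vol K) →L[ℝ] Lp (Fld n) 2 (vol K) →L[ℝ] Lp ℝ 1 (vol K) :=
  (innerSL ℝ : Fld n →L[ℝ] Fld n →L[ℝ] ℝ).holderL (vol K) 2 2 1

theorem coeFn_pairing (f g : Lp (Fld n) 2 (vol K)) :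
    pairing K f g =ᵐ[vol K] fun x => inner ℝ (f x) (g x) :=
  (innerSL ℝ : Fld n →L[ℝ] Fld n →L[ℝ] ℝ).coeFn_holder f g

theorem omegaZero_eq_pairing_sub (v r v' r' : Lp (Fld n) 2 (vol K)) :
    omegaZero v r v' r' = pairing K v r' - pairing K v' r := by
  apply Lp.ext
  refine (Integrable.coeFn_toL1 _).trans ?_
  filter_upwards [Lp.coeFn_sub (pairing K v r') (pairing K v' r), coeFn_pairing v r',
    coeFn_pairing v' r] with x hsub hvr' hv'r
  rw [hsub, Pi.sub_apply, Pi.sub_apply, hvr', hv'r]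

theorem integralCLM_pairing (f g : Lp (Fld n) 2 (vol K)) :
    L1.integralCLM (pairing K f g) = ∫ x in K, ∑ i, f x i * g x i := by
  rw [← L1.integral_eq, L1.integral_eq_integral]
  refine integral_congr_ae ?_
  filter_upwards [coeFn_pairing f g] with x hx
  simp only [hx, PiLp.inner_apply, RCLike.inner_apply, conj_trivial, mul_comm]

end Pairing

section ComponentsL2

/-- Square integrability of every component: the condition on a boundary field, such as a trace or
a numerical flux, under which the integrals over `∂K` in the theorem exist. -/
def ComponentsL2 {α ι : Type*} {_ : MeasurableSpace α} (ν : Measure α)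
    (f : α → EuclideanSpace ℝ ι) : Prop :=
  ∀ i, MemLp (fun x => f x i) 2 ν

variable {α ι : Type*} {_ : MeasurableSpace α} {ν : Measure α} {f g : α → EuclideanSpace ℝ ι}

theorem componentsL2_of_memLp [Fintype ι] (hf : MemLp f 2 ν) : ComponentsL2 ν f :=
  fun i => (EuclideanSpace.proj i : EuclideanSpace ℝ ι →L[ℝ] ℝ).comp_memLp' hf

theorem ComponentsL2.sub (hf : ComponentsL2 ν f) (hg : ComponentsL2 ν g) :
    ComponentsL2 ν fun x => f x - g x :=
  fun i => (hf i).sub (hg i)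

end ComponentsL2

section Boundary

variable {m n : ℕ} {κ : Type} [Fintype κ] {K : Set (Space m)}

theorem componentsL2_traceVec (f : Lp (EuclideanSpace ℝ κ) 2 (vol K)) :
    ComponentsL2 (surf (frontier K)) (traceVec f) :=
  fun i => Lp.memLp (trace K (comp i f))

theorem coeFn_comp (f : Lp (EuclideanSpace ℝ κ) 2 (vol K)) (i : κ) :
    comp i f =ᵐ[vol K] fun x => f x i :=
  (EuclideanSpace.proj i : EuclideanSpace ℝ κ →L[ℝ] ℝ).coeFn_compLp f

theorem integrable_apply_mul (f : Lp (EuclideanSpace ℝ κ) 2 (vol K)) (i : κ)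
    (g : Lp ℝ 2 (vol K)) : Integrable (fun x => f x i * g x) (vol K) :=
  (componentsL2_of_memLp (Lp.memLp f) i).integrable_mul (Lp.memLp g)

theorem IsSimplex.integrable_mul_outerNormal (hK : IsSimplex K) {f g : Space m → ℝ}
    (hf : MemLp f 2 (surf (frontier K))) (hg : MemLp g 2 (surf (frontier K))) (μ : Fin m) :
    Integrable (fun x => f x * g x * outerNormal K x μ) (surf (frontier K)) := by
  simp only [mul_assoc]
  exact hf.integrable_mul (hK.memLp_mul_outerNormal hg μ)

theorem IsSimplex.integrable_bdryInt (hK : IsSimplex K) {p : Space m → Fld n}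
    {q : Space m → Flx m n} (hp : ComponentsL2 (surf (frontier K)) p)
    (hq : ComponentsL2 (surf (frontier K)) q) :
    Integrable (fun x => ∑ i, ∑ μ, p x i * q x (μ, i) * outerNormal K x μ)
      (surf (frontier K)) :=
  integrable_finsetSum _ fun i _ => integrable_finsetSum _ fun μ _ =>
    hK.integrable_mul_outerNormal (hp i) (hq (μ, i)) μ

theorem IsSimplex.bdryWedge_eq (hK : IsSimplex K) {p p' : Space m → Fld n}
    {q q' : Space m → Flx m n} (hp : ComponentsL2 (surf (frontier K)) p)
    (hq : ComponentsL2 (surf (frontier K)) q) (hp' : ComponentsL2 (surf (frontier K)) p')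
    (hq' : ComponentsL2 (surf (frontier K)) q') :
    bdryWedge K p q p' q' = bdryInt K p q' - bdryInt K p' q := by
  rw [bdryInt, bdryInt, ← integral_sub (hK.integrable_bdryInt hp hq')
    (hK.integrable_bdryInt hp' hq), bdryWedge]
  simp only [sub_mul, Finset.sum_sub_distrib]

theorem IsSimplex.bdryInt_sub_left (hK : IsSimplex K) {p p' : Space m → Fld n}
    {q : Space m → Flx m n} (hp : ComponentsL2 (surf (frontier K)) p)
    (hp' : ComponentsL2 (surf (frontier K)) p') (hq : ComponentsL2 (surf (frontier K)) q) :
    bdryInt K (fun x => p x - p' x) q = bdryInt K p q - bdryInt K p' q := by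
  simp only [bdryInt, PiLp.sub_apply, sub_mul, Finset.sum_sub_distrib]
  exact integral_sub (hK.integrable_bdryInt hp hq) (hK.integrable_bdryInt hp' hq)

theorem IsSimplex.bdryInt_sub_right (hK : IsSimplex K) {p : Space m → Fld n}
    {q q' : Space m → Flx m n} (hp : ComponentsL2 (surf (frontier K)) p)
    (hq : ComponentsL2 (surf (frontier K)) q) (hq' : ComponentsL2 (surf (frontier K)) q') :
    bdryInt K p (fun x => q x - q' x) = bdryInt K p q - bdryInt K p q' := by
  simp only [bdryInt, PiLp.sub_apply, mul_sub, sub_mul, Finset.sum_sub_distrib]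
  exact integral_sub (hK.integrable_bdryInt hp hq) (hK.integrable_bdryInt hp hq')

theorem IsSimplex.bdryWedge_sub_sub (hK : IsSimplex K) {p p' w w' : Space m → Fld n}
    {q q' s s' : Space m → Flx m n} (hp : ComponentsL2 (surf (frontier K)) p)
    (hp' : ComponentsL2 (surf (frontier K)) p') (hw : ComponentsL2 (surf (frontier K)) w)
    (hw' : ComponentsL2 (surf (frontier K)) w') (hq : ComponentsL2 (surf (frontier K)) q)
    (hq' : ComponentsL2 (surf (frontier K)) q') (hs : ComponentsL2 (surf (frontier K)) s)
    (hs' : ComponentsL2 (surf (frontier K)) s') :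
    bdryWedge K (fun x => p x - w x) (fun x => q x - s x) (fun x => p' x - w' x)
        (fun x => q' x - s' x) =
      bdryWedge K p q p' q' - (bdryInt K p s' - bdryInt K p' s) -
        (bdryInt K w q' - bdryInt K w' q) + (bdryInt K w s' - bdryInt K w' s) := by
  rw [hK.bdryWedge_eq hp hq hp' hq',
    hK.bdryWedge_eq (hp.sub hw) (hq.sub hs) (hp'.sub hw') (hq'.sub hs'),
    hK.bdryInt_sub_left hp hw (hq'.sub hs'), hK.bdryInt_sub_left hp' hw' (hq.sub hs),
    hK.bdryInt_sub_right hp hq' hs', hK.bdryInt_sub_right hw hq' hs',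
    hK.bdryInt_sub_right hp' hq hs, hK.bdryInt_sub_right hw' hq hs]
  ring

theorem IsSimplex.integral_apply_mul_weakPartial_add (hK : IsSimplex K)
    {v : Lp (Fld n) 2 (vol K)} {τ : Lp (Flx m n) 2 (vol K)} (hv : ∀ i, MemH1 K (comp i v))
    (hτ : ∀ j, MemH1 K (comp j τ)) (i : Fin n) (μ : Fin m) :
    (∫ x in K, v x i * weakPartial K μ (comp (μ, i) τ) x) +
        ∫ x in K, τ x (μ, i) * weakPartial K μ (comp i v) x =
      ∫ x, traceVec v x i * traceVec τ x (μ, i) * outerNormal K x μ ∂surf (frontier K) := by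
  simp only [traceVec, mul_assoc]
  rw [← (hK.isTrace_trace (hv i)).setIntegral_mul_weakPartial_add hK
    (hK.isTrace_trace (hτ (μ, i))) μ]
  congr 1 <;> refine integral_congr_ae ?_
  · filter_upwards [coeFn_comp v i] with x hx
    rw [hx]
  · filter_upwards [coeFn_comp τ (μ, i)] with x hx
    rw [hx, mul_comm]

theorem IsSimplex.integral_sum_mul_weakPartial_add (hK : IsSimplex K)
    {v : Lp (Fld n) 2 (vol K)} {τ : Lp (Flx m n) 2 (vol K)} (hv : ∀ i, MemH1 K (comp i v))
    (hτ : ∀ j, MemH1 K (comp j τ)) :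
    (∫ x in K, ∑ i, ∑ μ, v x i * weakPartial K μ (comp (μ, i) τ) x) +
        ∫ x in K, ∑ i, ∑ μ, τ x (μ, i) * weakPartial K μ (comp i v) x =
      bdryInt K (traceVec v) (traceVec τ) := by
  have integral_sum_sum {ν : Measure (Space m)} {F : Fin n → Fin m → Space m → ℝ}
      (hF : ∀ i μ, Integrable (F i μ) ν) :
      ∫ x, ∑ i, ∑ μ, F i μ x ∂ν = ∑ i, ∑ μ, ∫ x, F i μ x ∂ν := by
    rw [integral_finsetSum _ fun i _ => integrable_finsetSum _ fun μ _ => hF i μ]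
    exact Finset.sum_congr rfl fun i _ => integral_finsetSum _ fun μ _ => hF i μ
  rw [bdryInt, integral_sum_sum fun i μ => integrable_apply_mul v i _,
    integral_sum_sum fun i μ => integrable_apply_mul τ (μ, i) _,
    integral_sum_sum fun i μ => hK.integrable_mul_outerNormal (componentsL2_traceVec v i)
      (componentsL2_traceVec τ (μ, i)) μ]
  simp only [← Finset.sum_add_distrib, hK.integral_apply_mul_weakPartial_add hv hτ]

end Boundary

section Elements

variable {m n : ℕ} {T : Geometry.SimplicialComplex ℝ (Space m)}

theorem isSimplex_body (K : Element T) : IsSimplex K.body := by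
  have hind := T.indep K.2.1
  have htop : affineSpan ℝ (range (Subtype.val : K.1 → Space m)) = ⊤ := by
    refine hind.affineSpan_eq_top_iff_card_eq_finrank_add_one.2 ?_
    rw [Fintype.card_coe, K.2.2, finrank_euclideanSpace, Fintype.card_fin]
  let b : AffineBasis K.1 ℝ (Space m) := ⟨Subtype.val, hind, htop⟩
  let e : K.1 ≃ Fin (m + 1) := Finset.equivFinOfCardEq K.2.2
  refine ⟨b.reindex e, ?_⟩
  rw [AffineBasis.coe_reindex, e.symm.surjective.range_comp]
  exact congrArg (convexHull ℝ) Subtype.range_coe.symm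

theorem IsTriangulation.ae_mem_domain {Ω : Set (Space m)} (hT : IsTriangulation T Ω)
    (K : Element T) : ∀ᵐ x ∂vol K.body, x ∈ Ω := by
  have hK := isSimplex_body K
  have hfrontier : ∀ᵐ x ∂vol K.body, x ∉ frontier K.body :=
    ae_restrict_of_ae (compl_mem_ae_iff.2 (hK.convex.addHaar_frontier volume))
  filter_upwards [hfrontier, ae_restrict_mem hK.isCompact.measurableSet] with x hx hxK
  rw [hT.eq_interior]
  refine interior_mono (Geometry.SimplicialComplex.convexHull_subset_space K.2.1) ?_
  by_contra hint
  exact hx ⟨subset_closure hxK, hint⟩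

theorem integral_hessian_symm {Ω : Set (Space m)} (hT : IsTriangulation T Ω)
    {H : Space m → Phase m n → ℝ} (hH : ∀ x ∈ Ω, ContDiff ℝ 2 (H x)) (K : Element T)
    (y z z' : Space m → Phase m n) :
    ∫ x in K.body, fderiv ℝ (fderiv ℝ (H x)) (y x) (z x) (z' x) =
      ∫ x in K.body, fderiv ℝ (fderiv ℝ (H x)) (y x) (z' x) (z x) := by
  refine integral_congr_ae ?_
  filter_upwards [hT.ae_mem_domain K] with x hx
  exact (hH x hx).contDiffAt.isSymmSndFDerivAt (by simp) _ _

variable {X : Spaces T n} {z z' : Fields X} {K : Element T} {t : ℝ}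

theorem componentsL2_uhat (z : Fields X) (K : Element T) (t : ℝ) :
    ComponentsL2 (surf (frontier K.body)) (z.uhat t).1 :=
  componentsL2_of_memLp ((Lp.memLp (z.uhat t).1).mono_measure
    (Measure.restrict_mono (subset_iUnion (fun K : Element T => frontier K.body) K) le_rfl))

theorem memH1_comp_V (v : X.V K) (i : Fin n) : MemH1 K.body (comp i v.1) :=
  fun μ => (X.V_H2 K v.1 v.2 i μ).imp fun _ h => h.1

theorem hasDerivAt_density
    (hu : DifferentiableAt ℝ (fun s => z.u s K) t) (hp : DifferentiableAt ℝ (fun s => z.p s K) t)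
    (hu' : DifferentiableAt ℝ (fun s => z'.u s K) t)
    (hp' : DifferentiableAt ℝ (fun s => z'.p s K) t) :
    HasDerivAt (density z z' K)
      ((pairing K.body (z.u t K).1 (deriv (fun s => z'.p s K) t).1 +
          pairing K.body (deriv (fun s => z.u s K) t).1 (z'.p t K).1) -
        (pairing K.body (z'.u t K).1 (deriv (fun s => z.p s K) t).1 +
          pairing K.body (deriv (fun s => z'.u s K) t).1 (z.p t K).1)) t := by
  have hasDerivAt_coe {W : Submodule ℝ (Lp (Fld n) 2 (vol K.body))} {w : ℝ → W}
      (hw : DifferentiableAt ℝ w t) : HasDerivAt (fun s => (w s).1) (deriv w t).1 t :=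
    W.subtypeL.hasFDerivAt.comp_hasDerivAt t hw.hasDerivAt
  have hdensity : density z z' K = fun s => pairing K.body (z.u s K).1 (z'.p s K).1 -
      pairing K.body (z'.u s K).1 (z.p s K).1 := funext fun s => omegaZero_eq_pairing_sub _ _ _ _
  rw [hdensity]
  exact ((pairing K.body).hasDerivAt_of_bilinear
      (fun _ => hasDerivAt_coe hu) (fun _ => hasDerivAt_coe hp')).sub
    ((pairing K.body).hasDerivAt_of_bilinear
      (fun _ => hasDerivAt_coe hu') (fun _ => hasDerivAt_coe hp))

theorem rateOfChange_eq
    (hu : DifferentiableAt ℝ (fun s => z.u s K) t) (hp : DifferentiableAt ℝ (fun s => z.p s K) t)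
    (hu' : DifferentiableAt ℝ (fun s => z'.u s K) t)
    (hp' : DifferentiableAt ℝ (fun s => z'.p s K) t) :
    rateOfChange z z' K t =
      ((∫ x in K.body, ∑ i, (deriv (fun s => z'.p s K) t).1 x i * (z.u t K).1 x i) +
          ∫ x in K.body, ∑ i, (deriv (fun s => z.u s K) t).1 x i * (z'.p t K).1 x i) -
        ((∫ x in K.body, ∑ i, (deriv (fun s => z.p s K) t).1 x i * (z'.u t K).1 x i) +
          ∫ x in K.body, ∑ i, (deriv (fun s => z'.u s K) t).1 x i * (z.p t K).1 x i) := by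
  rw [rateOfChange, ← L1.integral_eq_integral, L1.integral_eq,
    (hasDerivAt_density hu hp hu' hp').deriv, map_sub, map_add, map_add]
  simp only [integralCLM_pairing, mul_comm ((z.u t K).1 _ _), mul_comm ((z'.u t K).1 _ _)]

variable {G G' : Space m → Phase m n →L[ℝ] ℝ} {τhat τhat' : Space m → Flx m n}

namespace WeakEquations

theorem integral_covector_val (h : WeakEquations z G τhat K t) (z' : Fields X) :
    ∫ x in K.body, G x (z'.val K t x) =
      (∫ x in K.body, G x ((z'.u t K).1 x, 0, 0)) + (∫ x in K.body, G x (0, (z'.p t K).1 x, 0)) +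
        ∫ x in K.body, G x (0, 0, (z'.σ t K).1 x) := by
  rw [← integral_add' (h.int_v _) (h.int_r _),
    ← integral_add' ((h.int_v _).add (h.int_r _)) (h.int_τ _)]
  simp only [Fields.val, Pi.add_apply, ← map_add, Prod.mk_add_mk, add_zero, zero_add]

theorem integral_covector_τ (h : WeakEquations z G τhat K t) (τ : X.S K) :
    ∫ x in K.body, G x (0, 0, τ.1 x) = bdryInt K.body (z.uhat t).1 (traceVec τ.1) -
      ∫ x in K.body, ∑ i, ∑ μ, (z.u t K).1 x i * weakPartial K.body μ (comp (μ, i) τ.1) x := by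
  have heq := h.eq_τ τ
  rw [integral_add (integrable_finsetSum _ fun i _ => integrable_finsetSum _ fun μ _ =>
    integrable_apply_mul _ i _) (h.int_τ τ)] at heq
  linarith

theorem integral_covector_v (h : WeakEquations z G τhat K t) (v : X.V K) :
    ∫ x in K.body, G x (v.1 x, 0, 0) =
      (∫ x in K.body, ∑ i, ∑ μ, (z.σ t K).1 x (μ, i) * weakPartial K.body μ (comp i v.1) x) -
        bdryInt K.body (traceVec v.1) τhat -
        ∫ x in K.body, ∑ i, (deriv (fun s => z.p s K) t).1 x i * v.1 x i := by
  rw [h.eq_v v, integral_sub (integrable_finsetSum _ fun i _ => integrable_finsetSum _ fun μ _ =>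
    integrable_apply_mul _ (μ, i) _) (h.int_v v)]
  ring

theorem rateOfChange_eq_bdryWedge (h : WeakEquations z G τhat K t)
    (h' : WeakEquations z' G' τhat' K t)
    (hsymm : ∫ x in K.body, G x (z'.val K t x) = ∫ x in K.body, G' x (z.val K t x))
    (hτ : ComponentsL2 (surf (frontier K.body)) τhat)
    (hτ' : ComponentsL2 (surf (frontier K.body)) τhat') :
    rateOfChange z z' K t =
      -bdryWedge K.body (z.uhat t).1 τhat (z'.uhat t).1 τhat' +
        bdryWedge K.body
          (fun x => (z.uhat t).1 x - traceVec (z.u t K).1 x)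
          (fun x => τhat x - traceVec (z.σ t K).1 x)
          (fun x => (z'.uhat t).1 x - traceVec (z'.u t K).1 x)
          (fun x => τhat' x - traceVec (z'.σ t K).1 x) := by
  have hK := isSimplex_body K
  have parts (w w' : Fields X) := hK.integral_sum_mul_weakPartial_add
    (memH1_comp_V (w.u t K)) fun j => X.S_H1 K _ (w'.σ t K).2 j
  rw [h.integral_covector_val, h'.integral_covector_val, h.integral_covector_v,
    h'.integral_covector_v, h.integral_covector_τ, h'.integral_covector_τ, ← h.eq_r, ← h'.eq_r]
    at hsymm
  rw [hK.bdryWedge_sub_sub (componentsL2_uhat z K t) (componentsL2_uhat z' K t)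
    (componentsL2_traceVec _) (componentsL2_traceVec _) hτ hτ' (componentsL2_traceVec _)
    (componentsL2_traceVec _), rateOfChange_eq h.diff_u h.diff_p h'.diff_u h'.diff_p,
    ← parts z z', ← parts z' z]
  linarith

end WeakEquations

end Elements

end HybridDDW

open HybridDDW in
theorem mainTheorem5_general {m n : ℕ} {Ω : Set (Space m)}
    {T : Geometry.SimplicialComplex ℝ (Space m)} (hT : IsTriangulation T Ω) (X : Spaces T n)
    (t₀ t₁ : ℝ) (H : ℝ → Space m → Phase m n → ℝ)
    (hH : ∀ t ∈ Set.Ioo t₀ t₁, ∀ x ∈ Ω, ContDiff ℝ 2 (H t x))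
    (Φ : FluxFunction X) (y : Fields X)
    (hΦ : ∀ t ∈ Set.Ioo t₀ t₁, DifferentiableAt ℝ Φ (y.arg t)) (K : Element T) :
    (∀ z z' : Fields X, IsVariation H Φ t₀ t₁ y z K → IsVariation H Φ t₀ t₁ y z' K →
      ∀ t ∈ Set.Ioo t₀ t₁,
        DifferentiableAt ℝ (density z z' K) t ∧
        rateOfChange z z' K t = - boundaryFlux Φ y z z' K t + boundaryDefect Φ y z z' K t ∧
        (rateOfChange z z' K t = - boundaryFlux Φ y z z' K t ↔
          boundaryDefect Φ y z z' K t = 0)) ∧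
    ((∀ z z' : Fields X, IsVariation H Φ t₀ t₁ y z K → IsVariation H Φ t₀ t₁ y z' K →
        ∀ t ∈ Set.Ioo t₀ t₁, rateOfChange z z' K t = - boundaryFlux Φ y z z' K t) ↔
      (∀ z z' : Fields X, IsVariation H Φ t₀ t₁ y z K → IsVariation H Φ t₀ t₁ y z' K →
        ∀ t ∈ Set.Ioo t₀ t₁, boundaryDefect Φ y z z' K t = 0)) := by
  have rate_eq (z z' : Fields X) (hz : IsVariation H Φ t₀ t₁ y z K)
      (hz' : IsVariation H Φ t₀ t₁ y z' K) (t : ℝ) (ht : t ∈ Set.Ioo t₀ t₁) :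
      rateOfChange z z' K t = - boundaryFlux Φ y z z' K t + boundaryDefect Φ y z z' K t :=
    (hz t ht).rateOfChange_eq_bdryWedge (hz' t ht) (integral_hessian_symm hT (hH t ht) K _ _ _)
      (componentsL2_of_memLp (Lp.memLp _)) (componentsL2_of_memLp (Lp.memLp _))
  refine ⟨fun z z' hz hz' t ht => ⟨?_, rate_eq z z' hz hz' t ht, ?_⟩, ?_⟩
  · exact (hasDerivAt_density (hz t ht).diff_u (hz t ht).diff_p (hz' t ht).diff_u
      (hz' t ht).diff_p).differentiableAt
  · rw [rate_eq z z' hz hz' t ht, add_eq_left]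
  · refine forall₂_congr fun z z' => forall₂_congr fun hz hz' => forall₂_congr fun t ht => ?_
    rw [rate_eq z z' hz hz' t ht, add_eq_left]

open HybridDDW in
theorem mainTheorem5 {m n : ℕ} {Ω : Set (Space m)}
    {T : Geometry.SimplicialComplex ℝ (Space m)} [Fintype (Element T)]
    (hT : IsTriangulation T Ω) (X : Spaces T n) (t₀ t₁ : ℝ)
    (H : ℝ → Space m → Phase m n → ℝ)
    (hH : ∀ t ∈ Set.Ioo t₀ t₁, ∀ x ∈ Ω, ContDiff ℝ 2 (H t x))
    (Φ : FluxFunction X) (y : Fields X)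
    (hΦ : ∀ t ∈ Set.Ioo t₀ t₁, DifferentiableAt ℝ Φ (y.arg t))
    (K : Element T) (hy : ∀ t ∈ Set.Ioo t₀ t₁, SolvesOn H Φ y K t) :
    (∀ z z' : Fields X, IsVariation H Φ t₀ t₁ y z K → IsVariation H Φ t₀ t₁ y z' K →
      ∀ t ∈ Set.Ioo t₀ t₁,
        DifferentiableAt ℝ (density z z' K) t ∧
        rateOfChange z z' K t = - boundaryFlux Φ y z z' K t + boundaryDefect Φ y z z' K t ∧
        (rateOfChange z z' K t = - boundaryFlux Φ y z z' K t ↔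
          boundaryDefect Φ y z z' K t = 0)) ∧
    ((∀ z z' : Fields X, IsVariation H Φ t₀ t₁ y z K → IsVariation H Φ t₀ t₁ y z' K →
        ∀ t ∈ Set.Ioo t₀ t₁, rateOfChange z z' K t = - boundaryFlux Φ y z z' K t) ↔
      (∀ z z' : Fields X, IsVariation H Φ t₀ t₁ y z K → IsVariation H Φ t₀ t₁ y z' K →
        ∀ t ∈ Set.Ioo t₀ t₁, boundaryDefect Φ y z z' K t = 0)) :=
  mainTheorem5_general hT X t₀ t₁ H hH Φ y hΦ K
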